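/- Let $(M,g,J)$ be a Kähler manifold with Levi-Civita connection $\nabla$ (so $g(J\cdot,J\cdot)=g$, $\nabla J=0$), and let $\mathcal F$ be a smooth foliation of $M$ with tangent (vertical) distribution $\mathcal V$ and horizontal distribution $H=\mathcal V^{\perp_g}$. Assume that $\mathcal F$ is a Riemannian foliation, i.e. $\mathcal L_Vg$ vanishes on $H\times H$ for every local section $V$ of $\mathcal V$, that its leaves are totally geodesic, i.e. $\nabla_VW$ is a section of $\mathcal V$ for all local sections $V,W$ of $\mathcal V$, and that its leaves are complex submanifolds, i.e. $J\mathcal V\subseteq\mathcal V$. Define $$\hat g|_{\mathcal V\times\mathcal V}=\tfrac12\, g|_{\mathcal V\times\mathcal V},\quad \hat g|_{H\times H}=g|_{H\times H},\quad \hat g(\mathcal V,H)=0,\qquad \hat J|_{\mathcal V}=-J|_{\mathcal V},\quad \hat J|_{H}=J|_{H}.$$ Then $\hat g$ is a smooth Riemannian metric, $\hat J$ is a smooth almost complex structure, and $(M,\hat g,\hat J)$ is nearly Kähler: $\hat g(\hat J\cdot,\hat J\cdot)=\hat g$ and, with $\hat\nabla$ the Levi-Civita connection of $\hat g$, $(\hat\nabla_X\hat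 J)X=0$ for every vector field $X$. Moreover $\mathcal V$ and $H$ are parallel for the canonical Hermitian connection $$\overline\nabla_XY=\hat\nabla_XY+\tfrac12(\hat\nabla_X\hat J)\hat JY,$$ i.e. $\overline\nabla_XY$ is a section of $\mathcal V$ (resp. $H$) whenever $Y$ is. Thus $\overline\nabla$ has reduced holonomy: for every $p\in M$ each element of the holonomy group of $\overline\nabla$ at $p$ (parallel transports along piecewise $C^1$ loops at $p$) maps $\mathcal V_p$ into $\mathcal V_p$ and $H_p$ into $H_p$. -/

import Mathlib

open Set Bundle VectorField
open scoped Manifold ContDiff Topology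

noncomputable section

namespace KahlerFoliation

/-! Throughout, `M` is a smooth manifold modelled on the finite-dimensional real vector space `E`. -/

section Definitions

variable (E : Type*) [NormedAddCommGroup E] [NormedSpace ℝ E]
  (M : Type*) [TopologicalSpace M] [ChartedSpace E M]

variable [IsManifold 𝓘(ℝ, E) ∞ M]

/-- Affine connections on `M`: covariant derivatives on the tangent bundle. In Mathlib's convention
`cov Y x v` is the vector `(∇_v Y)(x)`. -/
abbrev AffineConnection := CovariantDerivative 𝓘(ℝ, E) E (TangentSpace 𝓘(ℝ, E) : M → Type _)

/-- Smooth Riemannian metrics on `M`; `g.inner x v w` is `g_x(v, w)`. -/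
abbrev Metric := ContMDiffRiemannianMetric 𝓘(ℝ, E) ∞ E (TangentSpace 𝓘(ℝ, E) : M → Type _)

/-- Smooth almost complex structures on `M`: smooth endomorphism fields with `J² = -1`. -/
structure AlmostComplex where
  /-- The endomorphism of each tangent space. -/
  toFun (x : M) : TangentSpace 𝓘(ℝ, E) x →L[ℝ] TangentSpace 𝓘(ℝ, E) x
  contMDiff : ContMDiff 𝓘(ℝ, E) (𝓘(ℝ, E).prod 𝓘(ℝ, E →L[ℝ] E)) ∞
    (fun x ↦ TotalSpace.mk' (E →L[ℝ] E)
      (E := fun x ↦ TangentSpace 𝓘(ℝ, E) x →L[ℝ] TangentSpace 𝓘(ℝ, E) x) x (toFun x))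
  sq (x : M) (v : TangentSpace 𝓘(ℝ, E) x) : toFun x (toFun x v) = -v

/-- A smooth foliation of `M`, given by its tangent distribution. Near every point the leaves are
the level sets of a smooth submersion, that is, the distribution is integrable. -/
structure Foliation where
  /-- The space of vectors tangent to the leaf through `x`. -/
  tangent (x : M) : Submodule ℝ (TangentSpace 𝓘(ℝ, E) x)
  integrable (x : M) : ∃ U : Set M, IsOpen U ∧ x ∈ U ∧
    ∃ (q : ℕ) (f : M → EuclideanSpace ℝ (Fin q)),
      ContMDiffOn 𝓘(ℝ, E) 𝓘(ℝ, EuclideanSpace ℝ (Fin q)) ∞ f U ∧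
      ∀ y ∈ U, Function.Surjective (mvfderiv 𝓘(ℝ, E) f y) ∧
        tangent y = (mvfderiv 𝓘(ℝ, E) f y).ker

end Definitions

variable {E : Type*} [NormedAddCommGroup E] [NormedSpace ℝ E]
  {M : Type*} [TopologicalSpace M] [ChartedSpace E M] [IsManifold 𝓘(ℝ, E) ∞ M]

/-- `X` restricts to a smooth vector field on `U` that takes its values in the distribution `D`. -/
structure IsLocalSection (D : ∀ x : M, Submodule ℝ (TangentSpace 𝓘(ℝ, E) x)) (U : Set M)
    (X : ∀ x : M, TangentSpace 𝓘(ℝ, E) x) : Prop where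
  contMDiffOn : ContMDiffOn 𝓘(ℝ, E) 𝓘(ℝ, E).tangent ∞ (T% X) U
  mem : ∀ x ∈ U, X x ∈ D x

/-- `D` is parallel for the affine connection `cov`: the derivative `∇_v Y` in any direction `v` of
any local smooth section `Y` of `D` lies in `D`. -/
def IsParallel (cov : AffineConnection E M)
    (D : ∀ x : M, Submodule ℝ (TangentSpace 𝓘(ℝ, E) x)) : Prop :=
  ∀ U : Set M, IsOpen U → ∀ Y, IsLocalSection D U Y → ∀ x ∈ U,
    ∀ v : TangentSpace 𝓘(ℝ, E) x, cov Y x v ∈ D x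

/-- `cov` is the Levi-Civita connection of `g`: it is torsion free, and `g` is parallel. -/
structure IsLeviCivita (g : Metric E M) (cov : AffineConnection E M) : Prop where
  torsion_free : ∀ (X Y : ∀ x : M, TangentSpace 𝓘(ℝ, E) x) (x : M),
    MDifferentiableAt 𝓘(ℝ, E) 𝓘(ℝ, E).tangent (T% X) x →
    MDifferentiableAt 𝓘(ℝ, E) 𝓘(ℝ, E).tangent (T% Y) x →
    cov Y x (X x) - cov X x (Y x) = mlieBracket 𝓘(ℝ, E) X Y x
  metric : ∀ (Y Z : ∀ x : M, TangentSpace 𝓘(ℝ, E) x) (x : M),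
    MDifferentiableAt 𝓘(ℝ, E) 𝓘(ℝ, E).tangent (T% Y) x →
    MDifferentiableAt 𝓘(ℝ, E) 𝓘(ℝ, E).tangent (T% Z) x → ∀ v : TangentSpace 𝓘(ℝ, E) x,
    mvfderiv 𝓘(ℝ, E) (fun y ↦ g.inner y (Y y) (Z y)) x v =
      g.inner x (cov Y x v) (Z x) + g.inner x (Y x) (cov Z x v)

/-- The metric `g` is Hermitian for `J`. -/
def IsAlmostHermitian (g : Metric E M) (J : AlmostComplex E M) : Prop :=
  ∀ (x : M) (v w : TangentSpace 𝓘(ℝ, E) x), g.inner x (J.toFun x v) (J.toFun x w) = g.inner x v w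

/-- `v ↦ (∇_v J) Y = ∇_v (J Y) - J (∇_v Y)` at `x`, for a vector field `Y`. -/
def nablaJAux (cov : AffineConnection E M) (J : AlmostComplex E M) (x : M)
    (Y : ∀ x : M, TangentSpace 𝓘(ℝ, E) x) : TangentSpace 𝓘(ℝ, E) x →L[ℝ] TangentSpace 𝓘(ℝ, E) x :=
  cov (fun y ↦ J.toFun y (Y y)) x - (J.toFun x) ∘L (cov Y x)

theorem AlmostComplex.mdifferentiableAt (J : AlmostComplex E M)
    {Y : ∀ x : M, TangentSpace 𝓘(ℝ, E) x} {x : M}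
    (hY : MDifferentiableAt 𝓘(ℝ, E) 𝓘(ℝ, E).tangent (T% Y) x) :
    MDifferentiableAt 𝓘(ℝ, E) 𝓘(ℝ, E).tangent (T% (fun y ↦ J.toFun y (Y y))) x :=
  MDifferentiableAt.clm_bundle_apply (F₁ := E) (F₂ := E)
    (E₁ := (TangentSpace 𝓘(ℝ, E) : M → Type _)) (E₂ := (TangentSpace 𝓘(ℝ, E) : M → Type _))
    (b := fun y ↦ y) ((J.contMDiff x).mdifferentiableAt (by simp)) hY

theorem tensorialAt_nablaJAux (cov : AffineConnection E M) (J : AlmostComplex E M) (x : M) :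
    TensorialAt 𝓘(ℝ, E) E (nablaJAux cov J x) x where
  smul {f σ} hf hσ := by
    have h1 : (fun y ↦ J.toFun y ((f • σ) y)) = f • (fun y ↦ J.toFun y (σ y)) := by
      ext y; simp
    ext v
    simp only [nablaJAux, h1]
    rw [cov.isCovariantDerivativeOn.leibniz (J.mdifferentiableAt hσ) hf,
      cov.isCovariantDerivativeOn.leibniz hσ hf]
    simp [smul_sub]
  add {σ σ'} hσ hσ' := by
    have h1 : (fun y ↦ J.toFun y ((σ + σ') y)) =
        (fun y ↦ J.toFun y (σ y)) + (fun y ↦ J.toFun y (σ' y)) := by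
      ext y; simp
    simp only [nablaJAux, h1]
    rw [cov.isCovariantDerivativeOn.add (J.mdifferentiableAt hσ) (J.mdifferentiableAt hσ'),
      cov.isCovariantDerivativeOn.add hσ hσ']
    ext v
    simp
    abel

namespace Foliation

/-- The horizontal distribution: the `g`-orthogonal complement of the tangent distribution. -/
def normal (F : Foliation E M) (g : Metric E M) (x : M) : Submodule ℝ (TangentSpace 𝓘(ℝ, E) x) where
  carrier := {w | ∀ v ∈ F.tangent x, g.inner x v w = 0}
  add_mem' ha hb v hv := by simp [ha v hv, hb v hv]
  zero_mem' v _ := by simp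
  smul_mem' c a ha v hv := by simp [ha v hv]

/-- The metric is bundle-like, i.e. the foliation is Riemannian: `L_V g` vanishes on horizontal
vectors for every local vector field `V` tangent to the leaves. -/
def IsRiemannian (F : Foliation E M) (g : Metric E M) : Prop :=
  ∀ U : Set M, IsOpen U → ∀ V X Y, IsLocalSection F.tangent U V →
    IsLocalSection (F.normal g) U X → IsLocalSection (F.normal g) U Y → ∀ x ∈ U,
    mvfderiv 𝓘(ℝ, E) (fun y ↦ g.inner y (X y) (Y y)) x (V x) =
      g.inner x (mlieBracket 𝓘(ℝ, E) V X x) (Y x) + g.inner x (X x) (mlieBracket 𝓘(ℝ, E) V Y x)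

/-- The leaves are totally geodesic: their second fundamental form vanishes, i.e. `∇_V W` is tangent
to the leaves whenever `V` and `W` are, for the Levi-Civita connection. -/
def IsTotallyGeodesic (F : Foliation E M) (g : Metric E M) : Prop :=
  ∃ cov : AffineConnection E M, IsLeviCivita g cov ∧
    ∀ U : Set M, IsOpen U → ∀ V W, IsLocalSection F.tangent U V → IsLocalSection F.tangent U W →
      ∀ x ∈ U, cov W x (V x) ∈ F.tangent x

/-- The leaves are complex submanifolds: their tangent spaces are `J`-invariant. -/
def HasComplexLeaves (F : Foliation E M) (J : AlmostComplex E M) : Prop :=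
  ∀ (x : M), ∀ v ∈ F.tangent x, J.toFun x v ∈ F.tangent x

/-- `g'` is obtained from `g` by halving it along the leaves: it equals `½ g` on vertical vectors,
`g` on horizontal vectors, and both distributions remain orthogonal. -/
structure IsLeafHalving (F : Foliation E M) (g g' : Metric E M) : Prop where
  vertical : ∀ (x : M), ∀ v ∈ F.tangent x, ∀ w ∈ F.tangent x,
    g'.inner x v w = (1 / 2 : ℝ) * g.inner x v w
  horizontal : ∀ (x : M), ∀ v ∈ F.normal g x, ∀ w ∈ F.normal g x,
    g'.inner x v w = g.inner x v w
  mixed : ∀ (x : M), ∀ v ∈ F.tangent x, ∀ w ∈ F.normal g x, g'.inner x v w = 0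

/-- `J'` is obtained from `J` by changing its sign along the leaves. -/
structure IsLeafReversal (F : Foliation E M) (g : Metric E M) (J J' : AlmostComplex E M) :
    Prop where
  vertical : ∀ (x : M), ∀ v ∈ F.tangent x, J'.toFun x v = -J.toFun x v
  horizontal : ∀ (x : M), ∀ v ∈ F.normal g x, J'.toFun x v = J.toFun x v

end Foliation

/-- The vector field `Y` along the curve `γ` is `cov`-parallel on `[a, b]`, i.e. `∇_{γ'} Y = 0`.
Let `e` be a local trivialization of the tangent bundle near `γ t` and `y` the expression of `Y` in
it; then `∇_{γ'} Y` at `t` corresponds to `y'(t)` plus the derivative in the direction `γ'(t)` of the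
local vector field which has the constant expression `y(t)`. -/
def IsParallelAlong (cov : AffineConnection E M) (γ : ℝ → M) (a b : ℝ)
    (Y : ∀ t : ℝ, TangentSpace 𝓘(ℝ, E) (γ t)) : Prop :=
  ∀ t ∈ Icc a b,
    let e := trivializationAt E (TangentSpace 𝓘(ℝ, E) : M → Type _) (γ t)
    HasDerivWithinAt (fun s ↦ e.continuousLinearMapAt ℝ (γ s) (Y s))
      (-(e.continuousLinearMapAt ℝ (γ t)
        (cov (fun x ↦ e.symmL ℝ x (e.continuousLinearMapAt ℝ (γ t) (Y t))) (γ t)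
          (mfderivWithin 𝓘(ℝ, ℝ) 𝓘(ℝ, E) γ (Icc a b) t (1 : ℝ))))) (Icc a b) t

/-- `IsParallelTransport cov p q τ`: the linear map `τ : T_pM → T_qM` is the `cov`-parallel transport
along some piecewise `C¹` curve from `p` to `q`. -/
inductive IsParallelTransport (cov : AffineConnection E M) (p : M) :
    (q : M) → (TangentSpace 𝓘(ℝ, E) p →L[ℝ] TangentSpace 𝓘(ℝ, E) q) → Prop
  | refl : IsParallelTransport cov p p (ContinuousLinearMap.id ℝ (TangentSpace 𝓘(ℝ, E) p))
  | segment (γ : ℝ → M) (a b : ℝ) (hab : a ≤ b)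
      (hγ : ContMDiffOn 𝓘(ℝ, ℝ) 𝓘(ℝ, E) 1 γ (Icc a b))
      (τ : TangentSpace 𝓘(ℝ, E) p →L[ℝ] TangentSpace 𝓘(ℝ, E) (γ a))
      (σ : TangentSpace 𝓘(ℝ, E) (γ a) →L[ℝ] TangentSpace 𝓘(ℝ, E) (γ b))
      (hτ : IsParallelTransport cov p (γ a) τ)
      (hσ : ∀ v : TangentSpace 𝓘(ℝ, E) (γ a), ∃ Y : ∀ t : ℝ, TangentSpace 𝓘(ℝ, E) (γ t),
        IsParallelAlong cov γ a b Y ∧ Y a = v ∧ Y b = σ v) :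
      IsParallelTransport cov p (γ b) (σ ∘L τ)

/-- The holonomy group of `cov` at `p`, as a set of endomorphisms of `T_pM`: the parallel transports
along piecewise `C¹` loops at `p`. -/
def holonomy (cov : AffineConnection E M) (p : M) :
    Set (TangentSpace 𝓘(ℝ, E) p →L[ℝ] TangentSpace 𝓘(ℝ, E) p) :=
  {h | IsParallelTransport cov p p h}

section FiniteDimensional

variable [FiniteDimensional ℝ E]

/-- The tensor `∇J`: the vector `nablaJ cov J x w v` is `(∇_v J) w`. -/
def nablaJ (cov : AffineConnection E M) (J : AlmostComplex E M) (x : M) :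
    TangentSpace 𝓘(ℝ, E) x →L[ℝ] TangentSpace 𝓘(ℝ, E) x →L[ℝ] TangentSpace 𝓘(ℝ, E) x :=
  TensorialAt.mkHom (nablaJAux cov J x) x (tensorialAt_nablaJAux cov J x)

theorem nablaJ_apply (cov : AffineConnection E M) (J : AlmostComplex E M) {x : M}
    {Y : ∀ x : M, TangentSpace 𝓘(ℝ, E) x} (hY : MDifferentiableAt 𝓘(ℝ, E) 𝓘(ℝ, E).tangent (T% Y) x)
    (v : TangentSpace 𝓘(ℝ, E) x) :
    nablaJ cov J x (Y x) v = cov (fun y ↦ J.toFun y (Y y)) x v - J.toFun x (cov Y x v) := by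
  rw [nablaJ, TensorialAt.mkHom_apply _ hY]
  rfl

/-- Kähler manifolds: almost Hermitian manifolds such that `∇J = 0` for the Levi-Civita
connection. -/
def IsKahler (g : Metric E M) (J : AlmostComplex E M) : Prop :=
  IsAlmostHermitian g J ∧ ∃ cov : AffineConnection E M, IsLeviCivita g cov ∧
    ∀ (x : M) (v w : TangentSpace 𝓘(ℝ, E) x), nablaJ cov J x w v = 0

/-- Nearly Kähler manifolds: almost Hermitian manifolds such that `(∇_X J) X = 0` for every `X`,
for the Levi-Civita connection. -/
def IsNearlyKahler (g : Metric E M) (J : AlmostComplex E M) : Prop :=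
  IsAlmostHermitian g J ∧ ∃ cov : AffineConnection E M, IsLeviCivita g cov ∧
    ∀ (x : M) (v : TangentSpace 𝓘(ℝ, E) x), nablaJ cov J x v v = 0

/-- When `cov` is the Levi-Civita connection, this is the canonical Hermitian connection
`∇_X Y + ½ (∇_X J) (J Y)`. -/
def canonicalHermitian (cov : AffineConnection E M) (J : AlmostComplex E M) :
    AffineConnection E M :=
  cov.addOneForm (fun x ↦ (1 / 2 : ℝ) • (nablaJ cov J x ∘L J.toFun x))

theorem canonicalHermitian_apply (cov : AffineConnection E M) (J : AlmostComplex E M)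
    (Y : ∀ x : M, TangentSpace 𝓘(ℝ, E) x) (x : M) (v : TangentSpace 𝓘(ℝ, E) x) :
    canonicalHermitian cov J Y x v =
      cov Y x v + (1 / 2 : ℝ) • nablaJ cov J x (J.toFun x (Y x)) v := rfl

end FiniteDimensional

end KahlerFoliation

end

/-! Let `P` be the `g`-orthogonal projection onto the leaves and `B y v = (∇_v P) y`. Each
hypothesis becomes a pointwise identity for `B`, and `KahlerSplitting` collects them. Since `P² = P`
and `P` is self-adjoint, `B(·, v)` is self-adjoint and exchanges vertical and horizontal vectors.
Totally geodesic leaves give `B(y, Pv) = 0`, the Riemannian condition makes `P B` skew, and `∇J = 0`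
with complex leaves makes `B` commute with `J` in its first slot. The rest is linear algebra at a
point.

The new structures are `g' = g((1 - ½P)·, ·)` and `J' = J(1 - 2P)`. The Levi-Civita connection of
`g'` is `∇ + A` with `A(y, v) = -½(B(Py, v) + B(Pv, y))`: this is symmetric, and it cancels `∇g'`
(`inner_correction`). Then `(∇'_v J')y = J(-2B(y, v) + B(Py, v) + B(Pv, y))` (`nabla_reversal`),
which vanishes for `y = v` because skewness gives `P B(v, v) = 0`.

By `canonical_correction` the canonical connection is `∇_v y + B(y, v) - 2B(Py, v)`. This equals
`P∇_v(Py) + (1 - P)∇_v((1 - P)y)`, the projection of `∇` to the splitting. Hence `g(P·, ·)` and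
`g((1 - P)·, ·)` are both parallel, with kernels the horizontal and the vertical distribution.
Parallel transport preserves the associated quadratic forms; as these are semidefinite, their null
vectors are exactly their kernels, so holonomy respects the splitting. No existence or uniqueness
theory for parallel transport is needed.

Smoothness of `P` holds because the tangent distribution is locally the kernel of the differential
of a submersion, and the projection onto such a kernel is read off from the inverse of `saddle`. -/

noncomputable section

namespace KahlerFoliation

/-! ### Orthogonal projection onto a kernel, smoothly in the data. -/

section Saddle

variable {E F : Type*} [NormedAddCommGroup E] [NormedSpace ℝ E] [NormedAddCommGroup F]
  [NormedSpace ℝ F]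

/-- The saddle point operator `(v, l) ↦ (G v + l ∘ D, D v)` of the quadratic form `G` under the
constraint `D v = 0`. -/
def saddle (G : E →L[ℝ] E →L[ℝ] ℝ) (D : E →L[ℝ] F) :
    E × (F →L[ℝ] ℝ) →L[ℝ] (E →L[ℝ] ℝ) × F :=
  .inl ℝ _ _ ∘L (G ∘L .fst ℝ _ _ + (ContinuousLinearMap.compL ℝ E F ℝ).flip D ∘L .snd ℝ _ _) +
    .inr ℝ _ _ ∘L D ∘L .fst ℝ _ _

theorem saddle_apply (G : E →L[ℝ] E →L[ℝ] ℝ) (D : E →L[ℝ] F) (v : E) (l : F →L[ℝ] ℝ) :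
    saddle G D (v, l) = (G v + l ∘L D, D v) := by
  simp [saddle]

theorem contDiff_saddle :
    ContDiff ℝ ∞ fun p : (E →L[ℝ] E →L[ℝ] ℝ) × (E →L[ℝ] F) ↦ saddle p.1 p.2 := by
  unfold saddle
  fun_prop

variable [FiniteDimensional ℝ E] [FiniteDimensional ℝ F]

theorem finrank_dual : Module.finrank ℝ (E →L[ℝ] ℝ) = Module.finrank ℝ E := by
  rw [← (LinearMap.toContinuousLinearMap (𝕜 := ℝ) (E := E) (F' := ℝ)).finrank_eq,
    Subspace.dual_finrank_eq]

/-- On a kernel element `(v, l)` one has `D v = 0`, so pairing `G v + l ∘ D` with `v` leaves `G v v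
= 0` and `v = 0`; surjectivity of `D` then kills `l`. Equality of dimensions does the rest. -/
theorem isInvertible_saddle {G : E →L[ℝ] E →L[ℝ] ℝ} {D : E →L[ℝ] F}
    (hG : ∀ v, v ≠ 0 → 0 < G v v) (hD : Function.Surjective D) : (saddle G D).IsInvertible := by
  have hinj : Function.Injective (saddle G D) := by
    rw [injective_iff_map_eq_zero]
    rintro ⟨v, l⟩ h
    rw [saddle_apply, Prod.mk_eq_zero] at h
    have hv : v = 0 := by
      by_contra hv
      have h1 := DFunLike.congr_fun h.1 v
      simp only [add_apply, ContinuousLinearMap.comp_apply, h.2, map_zero,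
        add_zero, zero_apply] at h1
      exact (hG v hv).ne' h1
    have hl : l = 0 := by
      ext w
      obtain ⟨u, rfl⟩ := hD w
      simpa [hv] using DFunLike.congr_fun h.1 u
    simp [hv, hl]
  have hrank : Module.finrank ℝ (E × (F →L[ℝ] ℝ)) = Module.finrank ℝ ((E →L[ℝ] ℝ) × F) := by
    rw [Module.finrank_prod, Module.finrank_prod, finrank_dual, finrank_dual]
  exact ⟨(LinearEquiv.ofInjectiveOfFinrankEq (saddle G D : _ →ₗ[ℝ] _) hinj
    hrank).toContinuousLinearEquiv, by ext <;> rfl⟩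

/-- The `G`-orthogonal projection onto the kernel of `D`. -/
def kerProj (G : E →L[ℝ] E →L[ℝ] ℝ) (D : E →L[ℝ] F) : E →L[ℝ] E :=
  .fst ℝ _ _ ∘L (saddle G D).inverse ∘L .inl ℝ _ _ ∘L G

/-- The second component `l` of the solution is a Lagrange multiplier: `G (v - kerProj G D v) = l ∘
D`, which vanishes on the kernel of `D`. -/
theorem kerProj_spec {G : E →L[ℝ] E →L[ℝ] ℝ} {D : E →L[ℝ] F}
    (hG : ∀ v, v ≠ 0 → 0 < G v v) (hD : Function.Surjective D) (v : E) :
    D (kerProj G D v) = 0 ∧ ∀ w, D w = 0 → G (v - kerProj G D v) w = 0 := by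
  obtain ⟨e, he⟩ := isInvertible_saddle hG hD
  set q := (saddle G D).inverse (G v, 0) with hq
  have h : saddle G D q = (G v, 0) := by
    rw [hq, ← he]
    simp
  have hk : kerProj G D v = q.1 := rfl
  rw [← Prod.mk.eta (p := q), saddle_apply, Prod.mk.injEq] at h
  refine ⟨hk ▸ h.2, fun w hw ↦ ?_⟩
  rw [hk, map_sub, ← h.1]
  simp [hw]

set_option synthInstance.maxHeartbeats 200000 in
theorem contDiffAt_kerProj {G : E →L[ℝ] E →L[ℝ] ℝ} {D : E →L[ℝ] F}
    (hG : ∀ v, v ≠ 0 → 0 < G v v) (hD : Function.Surjective D) :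
    ContDiffAt ℝ ∞ (fun p : (E →L[ℝ] E →L[ℝ] ℝ) × (E →L[ℝ] F) ↦ kerProj p.1 p.2) (G, D) := by
  have h1 : ContDiffAt ℝ ∞ (fun p : (E →L[ℝ] E →L[ℝ] ℝ) × (E →L[ℝ] F) ↦
      (saddle p.1 p.2).inverse) (G, D) :=
    ContDiffAt.comp (g := ContinuousLinearMap.inverse) (G, D)
      (isInvertible_saddle hG hD).contDiffAt_map_inverse contDiff_saddle.contDiffAt
  unfold kerProj
  fun_prop

end Saddle

/-! ### Chain rules along curves and for operator-valued maps. -/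

section Derivatives

variable {E : Type*} [NormedAddCommGroup E] [NormedSpace ℝ E]
  {M : Type*} [TopologicalSpace M] [ChartedSpace E M]

theorem hasDerivWithinAt_comp_curve {V : Type*} [NormedAddCommGroup V] [NormedSpace ℝ V]
    {f : M → V} {γ : ℝ → M} {s : Set ℝ} {t : ℝ} (hf : MDifferentiableAt 𝓘(ℝ, E) 𝓘(ℝ, V) f (γ t))
    (hγ : MDifferentiableWithinAt 𝓘(ℝ, ℝ) 𝓘(ℝ, E) γ s t) :
    HasDerivWithinAt (fun r ↦ f (γ r))
      (mvfderiv 𝓘(ℝ, E) f (γ t) (mfderivWithin 𝓘(ℝ, ℝ) 𝓘(ℝ, E) γ s t (1 : ℝ))) s t := by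
  have h : HasMFDerivWithinAt 𝓘(ℝ, ℝ) 𝓘(ℝ, V) (fun r ↦ f (γ r)) s t _ :=
    hf.hasMFDerivAt.comp_hasMFDerivWithinAt t hγ.hasMFDerivWithinAt
  let D : ℝ →L[ℝ] V := mvfderiv 𝓘(ℝ, E) f (γ t) ∘L mfderivWithin 𝓘(ℝ, ℝ) 𝓘(ℝ, E) γ s t
  have hD : HasFDerivWithinAt (fun r ↦ f (γ r)) D s t := h.hasFDerivWithinAt
  exact hD.hasDerivWithinAt

theorem mvfderiv_clm_apply_const {V W : Type*} [NormedAddCommGroup V] [NormedSpace ℝ V]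
    [NormedAddCommGroup W] [NormedSpace ℝ W] {f : M → V →L[ℝ] W} {x : M}
    (hf : MDifferentiableAt 𝓘(ℝ, E) 𝓘(ℝ, V →L[ℝ] W) f x) (u : V) (v : TangentSpace 𝓘(ℝ, E) x) :
    mvfderiv 𝓘(ℝ, E) (fun y ↦ f y u) x v = mvfderiv 𝓘(ℝ, E) f x v u := by
  have h : HasMFDerivAt 𝓘(ℝ, E) 𝓘(ℝ, W) (fun y ↦ f y u) x
      ((ContinuousLinearMap.apply ℝ W u) ∘L mfderiv 𝓘(ℝ, E) 𝓘(ℝ, V →L[ℝ] W) f x) :=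
    HasMFDerivAt.comp (I' := 𝓘(ℝ, V →L[ℝ] W)) x
      (ContinuousLinearMap.apply ℝ W u).hasMFDerivAt hf.hasMFDerivAt
  simp only [mvfderiv, h.mfderiv]
  rfl

theorem mdifferentiableAt_clm_apply_const {V W : Type*} [NormedAddCommGroup V] [NormedSpace ℝ V]
    [NormedAddCommGroup W] [NormedSpace ℝ W] {f : M → V →L[ℝ] W} {x : M}
    (hf : MDifferentiableAt 𝓘(ℝ, E) 𝓘(ℝ, V →L[ℝ] W) f x) (u : V) :
    MDifferentiableAt 𝓘(ℝ, E) 𝓘(ℝ, W) (fun y ↦ f y u) x :=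
  MDifferentiableAt.comp (I' := 𝓘(ℝ, V →L[ℝ] W)) x
    (ContinuousLinearMap.apply ℝ W u).mdifferentiableAt hf

end Derivatives

variable {E : Type*} [NormedAddCommGroup E] [NormedSpace ℝ E]
  {M : Type*} [TopologicalSpace M] [ChartedSpace E M] [IsManifold 𝓘(ℝ, E) ∞ M]

/-! ### Smooth tensor fields read in local trivializations. -/

/-- Smoothness of a field of endomorphisms of the tangent spaces. -/
def SmoothEndo (P : ∀ x : M, TangentSpace 𝓘(ℝ, E) x →L[ℝ] TangentSpace 𝓘(ℝ, E) x) : Prop :=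
  ContMDiff 𝓘(ℝ, E) (𝓘(ℝ, E).prod 𝓘(ℝ, E →L[ℝ] E)) ∞
    (fun x ↦ TotalSpace.mk' (E →L[ℝ] E)
      (E := fun x ↦ TangentSpace 𝓘(ℝ, E) x →L[ℝ] TangentSpace 𝓘(ℝ, E) x) x (P x))

/-- Smoothness of a field of bilinear forms on the tangent spaces. -/
def SmoothForm (Q : ∀ x : M, TangentSpace 𝓘(ℝ, E) x →L[ℝ] TangentSpace 𝓘(ℝ, E) x →L[ℝ] ℝ) : Prop :=
  ContMDiff 𝓘(ℝ, E) (𝓘(ℝ, E).prod 𝓘(ℝ, E →L[ℝ] E →L[ℝ] ℝ)) ∞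
    (fun x ↦ TotalSpace.mk' (E →L[ℝ] E →L[ℝ] ℝ)
      (E := fun x ↦ TangentSpace 𝓘(ℝ, E) x →L[ℝ] TangentSpace 𝓘(ℝ, E) x →L[ℝ] ℝ) x (Q x))

/-- A field of endomorphisms read in the trivialization of the tangent bundle at `x₀`. -/
def endoCoord (P : ∀ x : M, TangentSpace 𝓘(ℝ, E) x →L[ℝ] TangentSpace 𝓘(ℝ, E) x) (x₀ x : M) :
    E →L[ℝ] E :=
  let e := trivializationAt E (TangentSpace 𝓘(ℝ, E) : M → Type _) x₀
  e.continuousLinearMapAt ℝ x ∘L P x ∘L e.symmL ℝ x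

/-- A field of bilinear forms read in the trivialization of the tangent bundle at `x₀`. -/
def formCoord (Q : ∀ x : M, TangentSpace 𝓘(ℝ, E) x →L[ℝ] TangentSpace 𝓘(ℝ, E) x →L[ℝ] ℝ)
    (x₀ x : M) : E →L[ℝ] E →L[ℝ] ℝ :=
  let e := trivializationAt E (TangentSpace 𝓘(ℝ, E) : M → Type _) x₀
  (e.symmL ℝ x).precomp ℝ ∘L Q x ∘L e.symmL ℝ x

theorem eventually_mem_baseSet (x₀ : M) :
    ∀ᶠ x in 𝓝 x₀, x ∈ (trivializationAt E (TangentSpace 𝓘(ℝ, E) : M → Type _) x₀).baseSet :=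
  (trivializationAt E (TangentSpace 𝓘(ℝ, E) : M → Type _) x₀).open_baseSet.mem_nhds
    (FiberBundle.mem_baseSet_trivializationAt' x₀)

theorem smoothEndo_iff {P : ∀ x : M, TangentSpace 𝓘(ℝ, E) x →L[ℝ] TangentSpace 𝓘(ℝ, E) x} :
    SmoothEndo P ↔
      ∀ x₀ : M, ContMDiffAt 𝓘(ℝ, E) 𝓘(ℝ, E →L[ℝ] E) ∞ (endoCoord P x₀) x₀ := by
  refine forall_congr' fun x₀ ↦ ?_
  rw [contMDiffAt_hom_bundle]
  exact and_iff_right contMDiffAt_id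

theorem smoothForm_iff {Q : ∀ x : M, TangentSpace 𝓘(ℝ, E) x →L[ℝ] TangentSpace 𝓘(ℝ, E) x →L[ℝ] ℝ} :
    SmoothForm Q ↔
      ∀ x₀ : M, ContMDiffAt 𝓘(ℝ, E) 𝓘(ℝ, E →L[ℝ] E →L[ℝ] ℝ) ∞ (formCoord Q x₀) x₀ := by
  refine forall_congr' fun x₀ ↦ ?_
  rw [contMDiffAt_hom_bundle]
  refine (and_iff_right contMDiffAt_id).trans (Filter.EventuallyEq.contMDiffAt_iff ?_)
  filter_upwards [eventually_mem_baseSet (E := E) x₀] with y hy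
  ext v w
  erw [inCoordinates_apply_eq₂ hy hy (Set.mem_univ _)]
  simp only [formCoord, ContinuousLinearMap.comp_apply, ContinuousLinearMap.precomp_apply,
    Trivialization.symmL_apply _ hy]
  simp

theorem SmoothEndo.comp {P Q : ∀ x : M, TangentSpace 𝓘(ℝ, E) x →L[ℝ] TangentSpace 𝓘(ℝ, E) x}
    (hP : SmoothEndo P) (hQ : SmoothEndo Q) : SmoothEndo fun x ↦ P x ∘L Q x := by
  rw [smoothEndo_iff] at *
  refine fun x₀ ↦ ((hP x₀).clm_comp (hQ x₀)).congr_of_eventuallyEq ?_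
  filter_upwards [eventually_mem_baseSet (E := E) x₀] with y hy
  ext v
  simp only [endoCoord, ContinuousLinearMap.comp_apply]
  rw [Trivialization.symmL_continuousLinearMapAt _ hy]

theorem SmoothForm.comp {Q : ∀ x : M, TangentSpace 𝓘(ℝ, E) x →L[ℝ] TangentSpace 𝓘(ℝ, E) x →L[ℝ] ℝ}
    {P : ∀ x : M, TangentSpace 𝓘(ℝ, E) x →L[ℝ] TangentSpace 𝓘(ℝ, E) x}
    (hQ : SmoothForm Q) (hP : SmoothEndo P) : SmoothForm fun x ↦ Q x ∘L P x := by
  rw [smoothForm_iff] at *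
  rw [smoothEndo_iff] at hP
  refine fun x₀ ↦ ((hQ x₀).clm_comp (hP x₀)).congr_of_eventuallyEq ?_
  filter_upwards [eventually_mem_baseSet (E := E) x₀] with y hy
  ext v w
  simp only [formCoord, endoCoord, ContinuousLinearMap.comp_apply,
    ContinuousLinearMap.precomp_apply]
  rw [Trivialization.symmL_continuousLinearMapAt _ hy]

theorem SmoothEndo.add {P Q : ∀ x : M, TangentSpace 𝓘(ℝ, E) x →L[ℝ] TangentSpace 𝓘(ℝ, E) x}
    (hP : SmoothEndo P) (hQ : SmoothEndo Q) : SmoothEndo fun x ↦ P x + Q x := by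
  rw [smoothEndo_iff] at *
  refine fun x₀ ↦ ((hP x₀).add (hQ x₀)).congr_of_eventuallyEq (.of_forall fun y ↦ ?_)
  ext v
  simp [endoCoord]

theorem SmoothEndo.const_smul {P : ∀ x : M, TangentSpace 𝓘(ℝ, E) x →L[ℝ] TangentSpace 𝓘(ℝ, E) x}
    (hP : SmoothEndo P) (c : ℝ) : SmoothEndo fun x ↦ c • P x := by
  rw [smoothEndo_iff] at *
  refine fun x₀ ↦ ((contMDiffAt_const (I' := 𝓘(ℝ, ℝ)) (c := c)).smul (hP x₀)).congr_of_eventuallyEq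
    (.of_forall fun y ↦ ?_)
  ext v
  simp [endoCoord]

theorem smoothEndo_id :
    SmoothEndo fun x : M ↦ ContinuousLinearMap.id ℝ (TangentSpace 𝓘(ℝ, E) x) := by
  rw [smoothEndo_iff]
  refine fun x₀ ↦ (contMDiffAt_const (c := ContinuousLinearMap.id ℝ E)).congr_of_eventuallyEq ?_
  filter_upwards [eventually_mem_baseSet (E := E) x₀] with y hy
  ext v
  simp only [endoCoord, ContinuousLinearMap.comp_apply, ContinuousLinearMap.id_apply]
  rw [Trivialization.continuousLinearMapAt_symmL _ hy]

theorem SmoothEndo.mdifferentiableAt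
    {P : ∀ x : M, TangentSpace 𝓘(ℝ, E) x →L[ℝ] TangentSpace 𝓘(ℝ, E) x} (hP : SmoothEndo P)
    {Y : ∀ x : M, TangentSpace 𝓘(ℝ, E) x} {x : M}
    (hY : MDifferentiableAt 𝓘(ℝ, E) 𝓘(ℝ, E).tangent (T% Y) x) :
    MDifferentiableAt 𝓘(ℝ, E) 𝓘(ℝ, E).tangent (T% (fun y ↦ P y (Y y))) x :=
  MDifferentiableAt.clm_bundle_apply (F₁ := E) (F₂ := E)
    (E₁ := (TangentSpace 𝓘(ℝ, E) : M → Type _)) (E₂ := (TangentSpace 𝓘(ℝ, E) : M → Type _))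
    (b := fun y ↦ y) ((hP x).mdifferentiableAt (by simp)) hY

theorem SmoothEndo.contMDiffOn
    {P : ∀ x : M, TangentSpace 𝓘(ℝ, E) x →L[ℝ] TangentSpace 𝓘(ℝ, E) x} (hP : SmoothEndo P)
    {Y : ∀ x : M, TangentSpace 𝓘(ℝ, E) x} {U : Set M}
    (hY : ContMDiffOn 𝓘(ℝ, E) 𝓘(ℝ, E).tangent ∞ (T% Y) U) :
    ContMDiffOn 𝓘(ℝ, E) 𝓘(ℝ, E).tangent ∞ (T% (fun y ↦ P y (Y y))) U :=
  ContMDiffOn.clm_bundle_apply (F₁ := E) (F₂ := E)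
    (E₁ := (TangentSpace 𝓘(ℝ, E) : M → Type _)) (E₂ := (TangentSpace 𝓘(ℝ, E) : M → Type _))
    (b := fun y ↦ y) (ContMDiff.contMDiffOn hP) hY

theorem SmoothForm.mdifferentiableAt
    {Q : ∀ x : M, TangentSpace 𝓘(ℝ, E) x →L[ℝ] TangentSpace 𝓘(ℝ, E) x →L[ℝ] ℝ} (hQ : SmoothForm Q)
    {Y Z : ∀ x : M, TangentSpace 𝓘(ℝ, E) x} {x : M}
    (hY : MDifferentiableAt 𝓘(ℝ, E) 𝓘(ℝ, E).tangent (T% Y) x)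
    (hZ : MDifferentiableAt 𝓘(ℝ, E) 𝓘(ℝ, E).tangent (T% Z) x) :
    MDifferentiableAt 𝓘(ℝ, E) 𝓘(ℝ, ℝ) (fun y ↦ Q y (Y y) (Z y)) x := by
  have h : MDifferentiableAt 𝓘(ℝ, E) (𝓘(ℝ, E).prod 𝓘(ℝ, ℝ))
      (fun m ↦ TotalSpace.mk' ℝ (E := Bundle.Trivial M ℝ) m (Q m (Y m) (Z m))) x :=
    MDifferentiableAt.clm_bundle_apply₂ (F₁ := E) (F₂ := E)
      (E₁ := (TangentSpace 𝓘(ℝ, E) : M → Type _)) (E₂ := (TangentSpace 𝓘(ℝ, E) : M → Type _))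
      (b := fun y ↦ y) ((hQ x).mdifferentiableAt (by simp)) hY hZ
  rw [mdifferentiableAt_totalSpace] at h
  exact h.2

/-! ### The orthogonal projection onto the leaves. -/

section Projection

variable [FiniteDimensional ℝ E]

instance (x : M) : FiniteDimensional ℝ (TangentSpace 𝓘(ℝ, E) x) :=
  inferInstanceAs (FiniteDimensional ℝ E)

instance (x : M) : T2Space (TangentSpace 𝓘(ℝ, E) x) :=
  inferInstanceAs (T2Space E)

local notation "𝓣" => trivializationAt E (TangentSpace 𝓘(ℝ, E))

namespace Foliation

theorem isCompl_normal (F : Foliation E M) (g : Metric E M) (x : M) :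
    IsCompl (F.tangent x) (F.normal g x) := by
  let B : LinearMap.BilinForm ℝ (TangentSpace 𝓘(ℝ, E) x) :=
    (ContinuousLinearMap.coeLM ℝ).comp (g.inner x).toLinearMap
  have hB (v w) : B v w = g.inner x v w := rfl
  have hrefl : B.IsRefl := fun v w h ↦ by rw [hB] at *; rw [g.symm, h]
  have h : IsCompl (F.tangent x) (B.orthogonal (F.tangent x)) := by
    refine LinearMap.BilinForm.isCompl_orthogonal_of_restrict_nondegenerate hrefl ?_
    have key (v : F.tangent x) (hv : g.inner x (v : TangentSpace 𝓘(ℝ, E) x) v = 0) : v = 0 := by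
      by_contra hne
      exact (g.pos x v (by simpa using hne)).ne' hv
    exact ⟨fun v hv ↦ key v (hv v), fun v hv ↦ key v (hv v)⟩
  exact h

/-- The orthogonal projection onto the tangent distribution. -/
def proj (F : Foliation E M) (g : Metric E M) (x : M) :
    TangentSpace 𝓘(ℝ, E) x →L[ℝ] TangentSpace 𝓘(ℝ, E) x :=
  LinearMap.toContinuousLinearMap
    (Submodule.projection (F.tangent x) (F.normal g x) (F.isCompl_normal g x))

variable (F : Foliation E M) (g : Metric E M) {x : M}

theorem proj_mem (v : TangentSpace 𝓘(ℝ, E) x) : F.proj g x v ∈ F.tangent x := by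
  simp [proj]

theorem proj_of_mem {v : TangentSpace 𝓘(ℝ, E) x} (hv : v ∈ F.tangent x) : F.proj g x v = v :=
  Submodule.projection_apply_of_mem_left (F.isCompl_normal g x) hv

theorem proj_of_mem_normal {v : TangentSpace 𝓘(ℝ, E) x} (hv : v ∈ F.normal g x) :
    F.proj g x v = 0 :=
  (Submodule.projection_apply_eq_zero_iff (F.isCompl_normal g x)).2 hv

theorem proj_proj (v : TangentSpace 𝓘(ℝ, E) x) : F.proj g x (F.proj g x v) = F.proj g x v :=
  F.proj_of_mem g (F.proj_mem g v)

theorem sub_proj_mem (v : TangentSpace 𝓘(ℝ, E) x) : v - F.proj g x v ∈ F.normal g x := by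
  refine (Submodule.projection_apply_eq_zero_iff (F.isCompl_normal g x)).1 ?_
  change F.proj g x _ = 0
  rw [map_sub, proj_proj, sub_self]

theorem proj_eq_of_mem {v p : TangentSpace 𝓘(ℝ, E) x} (hp : p ∈ F.tangent x)
    (hv : v - p ∈ F.normal g x) : F.proj g x v = p := by
  have h := F.proj_of_mem_normal g hv
  rwa [map_sub, F.proj_of_mem g hp, sub_eq_zero] at h

theorem inner_proj_left (v w : TangentSpace 𝓘(ℝ, E) x) :
    g.inner x (F.proj g x v) w = g.inner x (F.proj g x v) (F.proj g x w) := by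
  have h := F.sub_proj_mem g w _ (F.proj_mem g v)
  rwa [map_sub, sub_eq_zero] at h

theorem inner_proj_comm (v w : TangentSpace 𝓘(ℝ, E) x) :
    g.inner x (F.proj g x v) w = g.inner x v (F.proj g x w) := by
  rw [F.inner_proj_left, g.symm x v, F.inner_proj_left g w, g.symm]

theorem mem_tangent_iff {v : TangentSpace 𝓘(ℝ, E) x} : v ∈ F.tangent x ↔ F.proj g x v = v :=
  ⟨F.proj_of_mem g, fun h ↦ h ▸ F.proj_mem g v⟩

theorem mem_normal_iff {v : TangentSpace 𝓘(ℝ, E) x} : v ∈ F.normal g x ↔ F.proj g x v = 0 :=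
  ⟨F.proj_of_mem_normal g, fun h ↦ by simpa [h] using F.sub_proj_mem g v⟩

/-- In a trivialization, `P` is `kerProj` of the coordinate metric and of the coordinate
differential of a local submersion `f` defining the leaves; both arguments vary smoothly. -/
theorem smoothEndo_proj : SmoothEndo (F.proj g) := by
  rw [smoothEndo_iff]
  intro x₀
  obtain ⟨U, hU, hx₀, q, f, hf, hfU⟩ := F.integrable x₀
  let D (y : M) : E →L[ℝ] EuclideanSpace ℝ (Fin q) := mvfderiv 𝓘(ℝ, E) f y ∘L (𝓣 x₀).symmL ℝ y
  have hD : ContMDiffAt 𝓘(ℝ, E) 𝓘(ℝ, E →L[ℝ] EuclideanSpace ℝ (Fin q)) ∞ D x₀ := by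
    have h := (hf.contMDiffAt (hU.mem_nhds hx₀)).mfderiv_const (m := ∞) (by simp)
    refine h.congr_of_eventuallyEq (.of_forall fun y ↦ ?_)
    simp only [inTangentCoordinates, ContinuousLinearMap.inCoordinates,
      TangentBundle.continuousLinearMapAt_model_space]
    rfl
  have hG := smoothForm_iff.1 g.contMDiff x₀
  have hpos {y : M} (hy : y ∈ (𝓣 x₀).baseSet) (v : E) (hv : v ≠ 0) : 0 < formCoord g.inner x₀ y v v := by
    refine g.pos y _ fun h ↦ hv ?_
    have h1 : (𝓣 x₀).continuousLinearMapAt ℝ y ((𝓣 x₀).symmL ℝ y v) = _ :=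
      congrArg ((𝓣 x₀).continuousLinearMapAt ℝ y) h
    rwa [map_zero, Trivialization.continuousLinearMapAt_symmL _ hy] at h1
  have hsurj {y : M} (hy : y ∈ (𝓣 x₀).baseSet) (hyU : y ∈ U) : Function.Surjective (D y) := fun u ↦ by
    obtain ⟨v, rfl⟩ := (hfU y hyU).1 u
    refine ⟨(𝓣 x₀).continuousLinearMapAt ℝ y v, ?_⟩
    simp only [D, ContinuousLinearMap.comp_apply]
    rw [Trivialization.symmL_continuousLinearMapAt _ hy]
  have hx₀e : x₀ ∈ (𝓣 x₀).baseSet := FiberBundle.mem_baseSet_trivializationAt' x₀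
  have hK := (contDiffAt_kerProj (hpos hx₀e) (hsurj hx₀e hx₀)).contMDiffAt.comp x₀
    (hG.prodMk_space hD)
  refine hK.congr_of_eventuallyEq ?_
  filter_upwards [eventually_mem_baseSet (E := E) x₀, hU.mem_nhds hx₀] with y hy hyU
  ext v
  obtain ⟨h1, h2⟩ := kerProj_spec (hpos hy) (hsurj hy hyU) v
  set p := kerProj (formCoord g.inner x₀ y) (D y) v with hp
  have h3 : F.proj g y ((𝓣 x₀).symmL ℝ y v) = (𝓣 x₀).symmL ℝ y p := by
    refine F.proj_eq_of_mem g ?_ fun w hw ↦ ?_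
    · rw [(hfU y hyU).2]
      exact h1
    · rw [(hfU y hyU).2] at hw
      have h4 := h2 ((𝓣 x₀).continuousLinearMapAt ℝ y w) (by
        simp only [D, ContinuousLinearMap.comp_apply]
        rw [Trivialization.symmL_continuousLinearMapAt _ hy]
        exact hw)
      simp only [formCoord, ContinuousLinearMap.comp_apply, ContinuousLinearMap.precomp_apply]
        at h4
      rw [Trivialization.symmL_continuousLinearMapAt _ hy, map_sub] at h4
      rw [g.symm]
      exact h4
  simp only [endoCoord, ContinuousLinearMap.comp_apply, h3, Function.comp_apply]
  rw [Trivialization.continuousLinearMapAt_symmL _ hy]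

end Foliation

end Projection

/-! ### Covariant derivative of an endomorphism field, and uniqueness of the Levi-Civita connection.
-/

section Connection

/-- `v ↦ (∇_v P) Y = ∇_v (P Y) - P (∇_v Y)` at `x`, for a field `P` of endomorphisms. -/
def nablaEndAux (cov : AffineConnection E M)
    (P : ∀ x : M, TangentSpace 𝓘(ℝ, E) x →L[ℝ] TangentSpace 𝓘(ℝ, E) x) (x : M)
    (Y : ∀ x : M, TangentSpace 𝓘(ℝ, E) x) : TangentSpace 𝓘(ℝ, E) x →L[ℝ] TangentSpace 𝓘(ℝ, E) x :=
  cov (fun y ↦ P y (Y y)) x - P x ∘L cov Y x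

variable (cov : AffineConnection E M)
  {P : ∀ x : M, TangentSpace 𝓘(ℝ, E) x →L[ℝ] TangentSpace 𝓘(ℝ, E) x}

theorem tensorialAt_nablaEndAux (hP : SmoothEndo P) (x : M) :
    TensorialAt 𝓘(ℝ, E) E (nablaEndAux cov P x) x where
  smul {f σ} hf hσ := by
    have h1 : (fun y ↦ P y ((f • σ) y)) = f • (fun y ↦ P y (σ y)) := by
      ext y; simp
    ext v
    simp only [nablaEndAux, h1]
    rw [cov.isCovariantDerivativeOn.leibniz (hP.mdifferentiableAt hσ) hf,
      cov.isCovariantDerivativeOn.leibniz hσ hf]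
    simp [smul_sub]
  add {σ σ'} hσ hσ' := by
    have h1 : (fun y ↦ P y ((σ + σ') y)) = (fun y ↦ P y (σ y)) + (fun y ↦ P y (σ' y)) := by
      ext y; simp
    simp only [nablaEndAux, h1]
    rw [cov.isCovariantDerivativeOn.add (hP.mdifferentiableAt hσ) (hP.mdifferentiableAt hσ'),
      cov.isCovariantDerivativeOn.add hσ hσ']
    ext v
    simp
    abel

variable {cov} in
theorem cov_fun_add {Y Z : ∀ x : M, TangentSpace 𝓘(ℝ, E) x} {x : M}
    (hY : MDifferentiableAt 𝓘(ℝ, E) 𝓘(ℝ, E).tangent (T% Y) x)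
    (hZ : MDifferentiableAt 𝓘(ℝ, E) 𝓘(ℝ, E).tangent (T% Z) x)
    (v : TangentSpace 𝓘(ℝ, E) x) :
    cov (fun y ↦ Y y + Z y) x v = cov Y x v + cov Z x v :=
  congrArg (· v) (cov.isCovariantDerivativeOn.add hY hZ)

variable {cov} in
theorem cov_fun_smul {Y : ∀ x : M, TangentSpace 𝓘(ℝ, E) x} {x : M}
    (hY : MDifferentiableAt 𝓘(ℝ, E) 𝓘(ℝ, E).tangent (T% Y) x) (c : ℝ)
    (v : TangentSpace 𝓘(ℝ, E) x) :
    cov (fun y ↦ c • Y y) x v = c • cov Y x v :=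
  congrArg (· v) (cov.isCovariantDerivativeOn.smul_const c hY)

theorem mdifferentiableAt_fun_smul {Y : ∀ x : M, TangentSpace 𝓘(ℝ, E) x} {x : M}
    (hY : MDifferentiableAt 𝓘(ℝ, E) 𝓘(ℝ, E).tangent (T% Y) x) (c : ℝ) :
    MDifferentiableAt 𝓘(ℝ, E) 𝓘(ℝ, E).tangent (T% (fun y ↦ c • Y y)) x :=
  (mdifferentiableAt_const (c := c)).smul_section hY

theorem exists_isOpen_contMDiffOn_extend {x : M} (v : TangentSpace 𝓘(ℝ, E) x) :
    ∃ U : Set M, IsOpen U ∧ x ∈ U ∧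
      ContMDiffOn 𝓘(ℝ, E) 𝓘(ℝ, E).tangent ∞ (T% (FiberBundle.extend E v)) U := by
  obtain ⟨s, hs, h⟩ := FiberBundle.exists_contMDiffOn_extend (k := ∞) 𝓘(ℝ, E) E v
  exact ⟨interior s, isOpen_interior, mem_interior_iff_mem_nhds.2 hs, h.mono interior_subset⟩

variable [FiniteDimensional ℝ E]

/-- The tensor `∇P`: the vector `nablaEnd cov hP x w v` is `(∇_v P) w`. -/
def nablaEnd (hP : SmoothEndo P) (x : M) :
    TangentSpace 𝓘(ℝ, E) x →L[ℝ] TangentSpace 𝓘(ℝ, E) x →L[ℝ] TangentSpace 𝓘(ℝ, E) x :=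
  TensorialAt.mkHom (nablaEndAux cov P x) x (tensorialAt_nablaEndAux cov hP x)

theorem nablaEnd_apply (hP : SmoothEndo P) {x : M} {Y : ∀ x : M, TangentSpace 𝓘(ℝ, E) x}
    (hY : MDifferentiableAt 𝓘(ℝ, E) 𝓘(ℝ, E).tangent (T% Y) x) (v : TangentSpace 𝓘(ℝ, E) x) :
    nablaEnd cov hP x (Y x) v = cov (fun y ↦ P y (Y y)) x v - P x (cov Y x v) := by
  rw [nablaEnd, TensorialAt.mkHom_apply _ hY]
  rfl

theorem cov_endo (hP : SmoothEndo P) {x : M} {Y : ∀ x : M, TangentSpace 𝓘(ℝ, E) x}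
    (hY : MDifferentiableAt 𝓘(ℝ, E) 𝓘(ℝ, E).tangent (T% Y) x) (v : TangentSpace 𝓘(ℝ, E) x) :
    cov (fun y ↦ P y (Y y)) x v = nablaEnd cov hP x (Y x) v + P x (cov Y x v) := by
  rw [nablaEnd_apply cov hP hY, sub_add_cancel]

/-- The Levi-Civita connection is unique. -/
theorem IsLeviCivita.unique {g : Metric E M} {cov cov' : AffineConnection E M}
    (h : IsLeviCivita g cov) (h' : IsLeviCivita g cov') {Y : ∀ x : M, TangentSpace 𝓘(ℝ, E) x}
    {x : M} (hY : MDifferentiableAt 𝓘(ℝ, E) 𝓘(ℝ, E).tangent (T% Y) x)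
    (v : TangentSpace 𝓘(ℝ, E) x) : cov Y x v = cov' Y x v := by
  set D := CovariantDerivative.difference cov cov' x with hD
  have hDY {Y : ∀ x : M, TangentSpace 𝓘(ℝ, E) x}
      (hY : MDifferentiableAt 𝓘(ℝ, E) 𝓘(ℝ, E).tangent (T% Y) x) (v : TangentSpace 𝓘(ℝ, E) x) :
      D (Y x) v = cov Y x v - cov' Y x v := by
    have := IsCovariantDerivativeOn.difference_apply cov.isCovariantDerivativeOnUniv
      cov'.isCovariantDerivativeOnUniv (mem_univ x) hY
    exact congrArg (· v) this
  have hext (v : TangentSpace 𝓘(ℝ, E) x) := FiberBundle.mdifferentiableAt_extend 𝓘(ℝ, E) E v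
  have hsymm (v w : TangentSpace 𝓘(ℝ, E) x) : D v w = D w v := by
    have h1 := hDY (hext v) w
    have h2 := hDY (hext w) v
    have h3 := h.torsion_free _ _ x (hext v) (hext w)
    have h4 := h'.torsion_free _ _ x (hext v) (hext w)
    simp only [FiberBundle.extend_apply_self] at h1 h2 h3 h4
    rw [h1, h2, sub_eq_sub_iff_sub_eq_sub, ← neg_inj, neg_sub, neg_sub, h3, ← h4]
  have hskew (u v w : TangentSpace 𝓘(ℝ, E) x) : g.inner x (D v u) w = - g.inner x (D w u) v := by
    have h1 := hDY (hext v) u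
    have h2 := hDY (hext w) u
    have h3 := h.metric _ _ x (hext v) (hext w) u
    have h4 := h'.metric _ _ x (hext v) (hext w) u
    simp only [FiberBundle.extend_apply_self] at h1 h2 h3 h4
    rw [h1, h2, map_sub, map_sub, sub_apply, sub_apply, g.symm x (cov (FiberBundle.extend E w) x u),
      g.symm x (cov' (FiberBundle.extend E w) x u)]
    linarith
  -- The trilinear form `g(D v u, w)` is symmetric in `v, u` and skew in `v, w`; going around the
  -- permutations, it equals its own negative.
  have hzero (u v w : TangentSpace 𝓘(ℝ, E) x) : g.inner x (D v u) w = 0 := by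
    have e1 := hskew u v w
    have e2 := hskew v w u
    have e3 := hskew w u v
    rw [hsymm w u] at e1
    rw [hsymm u v] at e2
    rw [hsymm v w] at e3
    linarith
  have hfin : D (Y x) v = 0 := by
    by_contra hne
    exact (g.pos x _ hne).ne' (hzero _ _ _)
  rwa [hDY hY, sub_eq_zero] at hfin

end Connection

/-! ### Linear algebra of the splitting at one point. -/

section PointwiseAlgebra

variable {T : Type*} [AddCommGroup T] [Module ℝ T] [TopologicalSpace T]
  [IsTopologicalAddGroup T] [ContinuousConstSMul ℝ T]

/-- The pointwise relations between the metric `g`, the orthogonal projection `P` onto the leaves,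
the complex structure `J` and the covariant derivative `B y v = (∇_v P) y` of the projection, for a
Riemannian foliation of a Kähler manifold with totally geodesic complex leaves. -/
structure KahlerSplitting (g : T →L[ℝ] T →L[ℝ] ℝ) (P J : T →L[ℝ] T) (B : T →L[ℝ] T →L[ℝ] T) :
    Prop where
  symm (v w : T) : g v w = g w v
  pos (v : T) (hv : v ≠ 0) : 0 < g v v
  proj_proj (v : T) : P (P v) = P v
  inner_proj (v w : T) : g (P v) w = g v (P w)
  proj_J (v : T) : P (J v) = J (P v)
  J_J (v : T) : J (J v) = -v
  inner_J (v w : T) : g (J v) (J w) = g v w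
  inner_B (y z v : T) : g (B y v) z = g y (B z v)
  B_proj (y v : T) : B (P y) v = B y v - P (B y v)
  B_proj_right (y v : T) : B y (P v) = 0
  proj_B_skew (y z : T) : P (B z y) = - P (B y z)
  B_J (y v : T) : B (J y) v = J (B y v)

namespace KahlerSplitting

variable {g : T →L[ℝ] T →L[ℝ] ℝ} {P J : T →L[ℝ] T} {B : T →L[ℝ] T →L[ℝ] T}

theorem ext_inner (h : KahlerSplitting g P J B) {v w : T} (H : ∀ z, g v z = g w z) : v = w := by
  by_contra hne
  refine (h.pos (v - w) (sub_ne_zero.2 hne)).ne' ?_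
  simp [H]

theorem proj_B_proj (h : KahlerSplitting g P J B) (y v : T) : P (B (P y) v) = 0 := by
  rw [h.B_proj, map_sub, h.proj_proj, sub_self]

theorem inner_J_left (h : KahlerSplitting g P J B) (v w : T) : g (J v) w = - g v (J w) := by
  rw [← h.inner_J v, h.J_J, map_neg, neg_neg]

/-- Skewness of `P B` carries `J`-linearity from the first slot of `P B` to the second. Taking
adjoints yields the statement, the sign arising because `J` is skew-adjoint. -/
theorem B_proj_J_right (h : KahlerSplitting g P J B) (y v : T) :
    B (P y) (J v) = - J (B (P y) v) := by
  refine h.ext_inner fun z ↦ ?_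
  have h1 (y v : T) : P (B y (J v)) = J (P (B y v)) := by
    rw [h.proj_B_skew, h.B_J, h.proj_J, h.proj_B_skew, map_neg, neg_neg]
  calc g (B (P y) (J v)) z = g y (J (P (B z v))) := by rw [h.inner_B, h.inner_proj, h1]
    _ = g (-J (B (P y) v)) z := by
      rw [map_neg, neg_apply, h.inner_J_left, neg_neg, h.inner_B, h.inner_proj, h.B_J, h.proj_J]

/-- The direction is the reversed structure `J(1 - 2P)` applied to `v`; its vertical correction is
invisible to `B`, so only `J v` counts. -/
theorem B_J_right_proj (h : KahlerSplitting g P J B) (y v : T) :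
    B (P y) (J v - (2 : ℝ) • J (P v)) = - J (B (P y) v) := by
  rw [← h.proj_J, map_sub, map_smul, h.B_proj_right, h.B_proj_J_right, smul_zero, sub_zero]

variable {A : T →L[ℝ] T →L[ℝ] T}

/-- The difference of the Levi-Civita connections compensates the derivative of the metric
`g - ½ g(P ·, ·)`. -/
theorem inner_correction (h : KahlerSplitting g P J B)
    (hA : ∀ y v, A y v = (-(1 / 2) : ℝ) • (B (P y) v + B (P v) y)) (y z v : T) :
    (g (A y v) z - (1 / 2) * g (P (A y v)) z) + (g y (A z v) - (1 / 2) * g (P y) (A z v)) =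
      -(1 / 2) * g (B y v) z := by
  -- The correction is horizontal, because `B` sends vertical vectors to horizontal ones.
  have h1 (y v : T) : P (A y v) = 0 := by
    rw [hA, map_smul, map_add, h.proj_B_proj, h.proj_B_proj, add_zero, smul_zero]
  have h2 : g (B (P v) y) z = g v (P (B z y)) := by rw [h.inner_B, h.inner_proj]
  have h3 : g (B (P v) z) y = - g v (P (B z y)) := by
    rw [h.inner_B, h.inner_proj, h.proj_B_skew z y, map_neg]
  have h4 : g (B (P y) v) z = g (B y v) z - g (P (B y v)) z := by
    rw [h.B_proj, map_sub, sub_apply]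
  have h5 : g (B (P z) v) y = g (P (B y v)) z := by
    rw [h.inner_B, h.inner_proj, h.symm]
  rw [h.inner_proj y, h1, h1, hA, hA, h.symm y]
  simp only [map_smul, map_add, smul_apply, add_apply, smul_eq_mul, map_zero, zero_apply]
  rw [h2, h3, h4, h5]
  ring

/-- The covariant derivative of `J - 2 J P` for the corrected connection. -/
theorem nabla_reversal (h : KahlerSplitting g P J B)
    (hA : ∀ y v, A y v = (-(1 / 2) : ℝ) • (B (P y) v + B (P v) y)) (y v : T) :
    - (2 : ℝ) • J (B y v) + A (J y - (2 : ℝ) • J (P y)) v -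
        (J (A y v) - (2 : ℝ) • J (P (A y v))) =
      J (-(2 : ℝ) • B y v + B (P y) v + B (P v) y) := by
  have h1 (y v : T) : P (A y v) = 0 := by
    rw [hA, map_smul, map_add, h.proj_B_proj, h.proj_B_proj, add_zero, smul_zero]
  have h2 : P (J y - (2 : ℝ) • J (P y)) = - J (P y) := by
    rw [map_sub, map_smul, h.proj_J, h.proj_J, h.proj_proj]
    module
  rw [h1, hA, hA, h2, h.B_J_right_proj, map_neg, neg_apply, h.B_J]
  simp only [map_add, map_smul, map_zero]
  module

/-- Skewness gives `P (B v v) = 0`, hence `B (P v) v = B v v` and the three terms cancel. -/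
theorem nabla_reversal_self (h : KahlerSplitting g P J B) (v : T) :
    J (-(2 : ℝ) • B v v + B (P v) v + B (P v) v) = 0 := by
  have h1 : P (B v v) = 0 := by
    have h2 := eq_neg_iff_add_eq_zero.1 (h.proj_B_skew v v)
    rw [← two_smul ℝ] at h2
    exact (smul_eq_zero.1 h2).resolve_left two_ne_zero
  rw [h.B_proj, h1, sub_zero]
  convert map_zero J using 2
  module

/-- The correction from the original Levi-Civita connection to the canonical Hermitian one. -/
theorem canonical_correction (h : KahlerSplitting g P J B)
    (hA : ∀ y v, A y v = (-(1 / 2) : ℝ) • (B (P y) v + B (P v) y)) (y v : T) :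
    A y v + (1 / 2 : ℝ) • J (-(2 : ℝ) • B (J y - (2 : ℝ) • J (P y)) v +
      B (P (J y - (2 : ℝ) • J (P y))) v + B (P v) (J y - (2 : ℝ) • J (P y))) =
      B y v - (2 : ℝ) • B (P y) v := by
  have h2 : P (J y - (2 : ℝ) • J (P y)) = - J (P y) := by
    rw [map_sub, map_smul, h.proj_J, h.proj_J, h.proj_proj]
    module
  rw [hA, h2, h.B_J_right_proj]
  simp only [map_add, map_smul, map_sub, map_neg, sub_apply, smul_apply, neg_apply, h.B_J, h.J_J]
  module

/-- The right side is the `∇`-derivative of the form `g(P·, ·)`; the left side is what the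
correction term of the canonical connection contributes. Their equality makes this form parallel. -/
theorem inner_proj_parallel (h : KahlerSplitting g P J B) (y z v : T) :
    g (P (B y v - (2 : ℝ) • B (P y) v)) z + g (P y) (B z v - (2 : ℝ) • B (P z) v) =
      g (B y v) z := by
  have h1 (y : T) : P (B y v - (2 : ℝ) • B (P y) v) = P (B y v) := by
    rw [map_sub, map_smul, h.proj_B_proj, smul_zero, sub_zero]
  rw [h.inner_proj y, h1, h1, ← h.inner_proj y, ← h.inner_B, h.B_proj, map_sub, sub_apply]
  ring

/-- The canonical correction is skew for `g`, so the canonical connection is also metric for the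
original `g`. -/
theorem inner_parallel (h : KahlerSplitting g P J B) (y z v : T) :
    g (B y v - (2 : ℝ) • B (P y) v) z + g y (B z v - (2 : ℝ) • B (P z) v) = 0 := by
  have h1 : g y (B (P z) v) = g (P (B y v)) z := by rw [← h.inner_B, h.inner_proj]
  simp only [map_sub, map_smul, sub_apply, smul_apply, smul_eq_mul, ← h.inner_B y z, h1]
  rw [h.B_proj, map_sub, sub_apply]
  ring

end KahlerSplitting

end PointwiseAlgebra

/-! ### The geometric hypotheses as identities for the derivative of the projection. -/

section KahlerFoliations

theorem AlmostComplex.smoothEndo (J : AlmostComplex E M) : SmoothEndo J.toFun := J.contMDiff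

theorem smoothForm_metric (g : Metric E M) : SmoothForm g.inner := g.contMDiff

theorem mdifferentiableAt_extend {x : M} (v : TangentSpace 𝓘(ℝ, E) x) :
    MDifferentiableAt 𝓘(ℝ, E) 𝓘(ℝ, E).tangent (T% (FiberBundle.extend E v)) x :=
  FiberBundle.mdifferentiableAt_extend 𝓘(ℝ, E) E v

variable [FiniteDimensional ℝ E]

variable {g : Metric E M} {J : AlmostComplex E M} {F : Foliation E M} {cov : AffineConnection E M}

/-- The Kähler condition provides some Levi-Civita connection; uniqueness transfers it to the given
`cov`. -/
theorem IsKahler.cov_J (hK : IsKahler g J) (hcov : IsLeviCivita g cov)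
    {Y : ∀ x : M, TangentSpace 𝓘(ℝ, E) x} {x : M}
    (hY : MDifferentiableAt 𝓘(ℝ, E) 𝓘(ℝ, E).tangent (T% Y) x) (v : TangentSpace 𝓘(ℝ, E) x) :
    cov (fun y ↦ J.toFun y (Y y)) x v = J.toFun x (cov Y x v) := by
  obtain ⟨-, cov', hcov', h⟩ := hK
  have h1 := nablaJ_apply cov' J hY v
  rw [h, eq_comm, sub_eq_zero] at h1
  rw [hcov.unique hcov' hY, hcov.unique hcov' (J.mdifferentiableAt hY), h1]

namespace Foliation

theorem IsTotallyGeodesic.cov_mem (hG : F.IsTotallyGeodesic g) (hcov : IsLeviCivita g cov)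
    {U : Set M} (hU : IsOpen U) {V W : ∀ x : M, TangentSpace 𝓘(ℝ, E) x}
    (hV : IsLocalSection F.tangent U V) (hW : IsLocalSection F.tangent U W) {x : M} (hx : x ∈ U) :
    cov W x (V x) ∈ F.tangent x := by
  obtain ⟨cov', hcov', h⟩ := hG
  rw [hcov.unique hcov' ((hW.contMDiffOn.contMDiffAt (hU.mem_nhds hx)).mdifferentiableAt (by simp))]
  exact h U hU V W hV hW x hx

theorem isLocalSection_proj {U : Set M} {Y : ∀ x : M, TangentSpace 𝓘(ℝ, E) x}
    (hY : ContMDiffOn 𝓘(ℝ, E) 𝓘(ℝ, E).tangent ∞ (T% Y) U) :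
    IsLocalSection F.tangent U fun y ↦ F.proj g y (Y y) :=
  ⟨(F.smoothEndo_proj g).contMDiffOn hY, fun _ _ ↦ F.proj_mem g _⟩

theorem isLocalSection_sub_proj {U : Set M} {Y : ∀ x : M, TangentSpace 𝓘(ℝ, E) x}
    (hY : ContMDiffOn 𝓘(ℝ, E) 𝓘(ℝ, E).tangent ∞ (T% Y) U) :
    IsLocalSection (F.normal g) U fun y ↦ Y y - F.proj g y (Y y) := by
  refine ⟨fun x hx ↦ ?_, fun _ _ ↦ F.sub_proj_mem g _⟩
  exact ContMDiffWithinAt.sub_section (hY x hx) ((F.smoothEndo_proj g).contMDiffOn hY x hx)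

/-- An isometry `J` with `J² = -1` preserving the leaves also preserves their orthogonal complement.
-/
theorem proj_J (hK : IsKahler g J) (hC : F.HasComplexLeaves J) {x : M}
    (v : TangentSpace 𝓘(ℝ, E) x) : F.proj g x (J.toFun x v) = J.toFun x (F.proj g x v) := by
  refine F.proj_eq_of_mem g (hC _ _ (F.proj_mem g v)) fun w hw ↦ ?_
  rw [← map_sub, ← hK.1, J.sq, map_neg, F.sub_proj_mem g v _ (hC _ _ hw), neg_zero]

/-- Differentiate `g(PY, Z) = g(Y, PZ)`. -/
theorem inner_nablaEnd_proj (hcov : IsLeviCivita g cov) {x : M} (y z v : TangentSpace 𝓘(ℝ, E) x) :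
    g.inner x (nablaEnd cov (F.smoothEndo_proj g) x y v) z =
      g.inner x y (nablaEnd cov (F.smoothEndo_proj g) x z v) := by
  have hs := F.smoothEndo_proj g
  have hy := mdifferentiableAt_extend y
  have hz := mdifferentiableAt_extend z
  have h1 := hcov.metric _ _ x (hs.mdifferentiableAt hy) hz v
  have h2 := hcov.metric _ _ x hy (hs.mdifferentiableAt hz) v
  rw [show (fun a ↦ g.inner a (F.proj g a (FiberBundle.extend E y a)) (FiberBundle.extend E z a)) =
    fun a ↦ g.inner a (FiberBundle.extend E y a) (F.proj g a (FiberBundle.extend E z a)) from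
    funext fun a ↦ F.inner_proj_comm g _ _, h2, cov_endo cov hs hy, cov_endo cov hs hz] at h1
  simp only [FiberBundle.extend_apply_self, map_add, add_apply] at h1
  rw [F.inner_proj_comm, F.inner_proj_comm] at h1
  linarith

/-- Differentiate `P² = P`. -/
theorem nablaEnd_proj_proj {x : M} (y v : TangentSpace 𝓘(ℝ, E) x) :
    nablaEnd cov (F.smoothEndo_proj g) x (F.proj g x y) v =
      nablaEnd cov (F.smoothEndo_proj g) x y v -
        F.proj g x (nablaEnd cov (F.smoothEndo_proj g) x y v) := by
  have hs := F.smoothEndo_proj g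
  have hy := mdifferentiableAt_extend y
  have h1 := nablaEnd_apply cov hs (hs.mdifferentiableAt hy) v
  simp only [F.proj_proj] at h1
  rw [cov_endo cov hs hy] at h1
  simp only [FiberBundle.extend_apply_self, map_add, F.proj_proj] at h1
  rw [h1]
  abel

/-- Totally geodesic leaves settle vertical `y`. For general `y` the value is then vertical by
`nablaEnd_proj_proj`, and self-adjointness reduces its squared norm to the vertical case. -/
theorem nablaEnd_proj_tangent (hcov : IsLeviCivita g cov) (hG : F.IsTotallyGeodesic g) {x : M}
    (y v : TangentSpace 𝓘(ℝ, E) x) :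
    nablaEnd cov (F.smoothEndo_proj g) x y (F.proj g x v) = 0 := by
  have hs := F.smoothEndo_proj g
  have key (y : TangentSpace 𝓘(ℝ, E) x) :
      nablaEnd cov hs x (F.proj g x y) (F.proj g x v) = 0 := by
    obtain ⟨U, hU, hxU, hyU⟩ := exists_isOpen_contMDiffOn_extend y
    obtain ⟨W, hW, hxW, hvW⟩ := exists_isOpen_contMDiffOn_extend v
    have hy := mdifferentiableAt_extend y
    have h1 := hG.cov_mem hcov (hU.inter hW)
      (isLocalSection_proj (g := g) (hvW.mono inter_subset_right))
      (isLocalSection_proj (g := g) (hyU.mono inter_subset_left)) ⟨hxU, hxW⟩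
    have h2 := nablaEnd_apply cov hs (hs.mdifferentiableAt hy) (F.proj g x v)
    simp only [FiberBundle.extend_apply_self] at h1 h2
    rw [h2, F.proj_of_mem g h1]
    simp only [F.proj_proj, sub_self]
  have hP (y : TangentSpace 𝓘(ℝ, E) x) :
      F.proj g x (nablaEnd cov hs x y (F.proj g x v)) = nablaEnd cov hs x y (F.proj g x v) := by
    have h1 := nablaEnd_proj_proj (cov := cov) (F := F) (g := g) y (F.proj g x v)
    rw [key, eq_comm, sub_eq_zero] at h1
    exact h1.symm
  by_contra hne
  refine (g.pos x _ hne).ne' ?_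
  nth_rw 1 [← hP]
  rw [F.inner_proj_comm, inner_nablaEnd_proj hcov, key, map_zero]

/-- Apply the bundle-like condition to the vertical field `PV`. Rewriting brackets by
torsion-freeness leaves `g(∇_X(PV), Y) + g(X, ∇_Y(PV)) = 0`, and in `∇_X(PV) = B(V, X) + P∇_X V` the
last term is orthogonal to `Y`. -/
theorem IsRiemannian.inner_nablaEnd_add (hR : F.IsRiemannian g) (hcov : IsLeviCivita g cov)
    {U : Set M} (hU : IsOpen U) {V X Y : ∀ x : M, TangentSpace 𝓘(ℝ, E) x}
    (hV : ContMDiffOn 𝓘(ℝ, E) 𝓘(ℝ, E).tangent ∞ (T% V) U)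
    (hX : IsLocalSection (F.normal g) U X) (hY : IsLocalSection (F.normal g) U Y) {x : M}
    (hx : x ∈ U) :
    g.inner x (nablaEnd cov (F.smoothEndo_proj g) x (V x) (X x)) (Y x) +
      g.inner x (X x) (nablaEnd cov (F.smoothEndo_proj g) x (V x) (Y x)) = 0 := by
  have hs := F.smoothEndo_proj g
  have hdiff {Z : ∀ x : M, TangentSpace 𝓘(ℝ, E) x}
      (hZ : ContMDiffOn 𝓘(ℝ, E) 𝓘(ℝ, E).tangent ∞ (T% Z) U) :
      MDifferentiableAt 𝓘(ℝ, E) 𝓘(ℝ, E).tangent (T% Z) x :=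
    (hZ.contMDiffAt (hU.mem_nhds hx)).mdifferentiableAt (by simp)
  have hPV := hs.mdifferentiableAt (hdiff hV)
  have h1 := hR U hU _ X Y (isLocalSection_proj (g := g) hV) hX hY x hx
  rw [hcov.metric X Y x (hdiff hX.1) (hdiff hY.1), ← hcov.torsion_free _ X x hPV (hdiff hX.1),
    ← hcov.torsion_free _ Y x hPV (hdiff hY.1), cov_endo cov hs (hdiff hV),
    cov_endo cov hs (hdiff hV)] at h1
  have h2 := hY.2 x hx _ (F.proj_mem g (cov V x (X x)))
  have h3 := hX.2 x hx _ (F.proj_mem g (cov V x (Y x)))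
  rw [g.symm] at h3
  simp only [map_sub, map_add, sub_apply, add_apply] at h1
  linarith

theorem proj_nablaEnd_skew (hcov : IsLeviCivita g cov) (hR : F.IsRiemannian g)
    (hG : F.IsTotallyGeodesic g) {x : M} (y z : TangentSpace 𝓘(ℝ, E) x) :
    F.proj g x (nablaEnd cov (F.smoothEndo_proj g) x z y) =
      -F.proj g x (nablaEnd cov (F.smoothEndo_proj g) x y z) := by
  set B := nablaEnd cov (F.smoothEndo_proj g) x with hB
  have key (v y z : TangentSpace 𝓘(ℝ, E) x) :
      g.inner x (B v (y - F.proj g x y)) (z - F.proj g x z) +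
        g.inner x (y - F.proj g x y) (B v (z - F.proj g x z)) = 0 := by
    obtain ⟨U₁, hU₁, hx₁, hv₁⟩ := exists_isOpen_contMDiffOn_extend v
    obtain ⟨U₂, hU₂, hx₂, hy₂⟩ := exists_isOpen_contMDiffOn_extend y
    obtain ⟨U₃, hU₃, hx₃, hz₃⟩ := exists_isOpen_contMDiffOn_extend z
    have h1 := hR.inner_nablaEnd_add hcov ((hU₁.inter hU₂).inter hU₃)
      (hv₁.mono (inter_subset_left.trans inter_subset_left))
      (isLocalSection_sub_proj (hy₂.mono (inter_subset_left.trans inter_subset_right)))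
      (isLocalSection_sub_proj (hz₃.mono inter_subset_right)) (x := x) ⟨⟨hx₁, hx₂⟩, hx₃⟩
    simpa only [FiberBundle.extend_apply_self] using h1
  have hBr (y z : TangentSpace 𝓘(ℝ, E) x) : B z (y - F.proj g x y) = B z y := by
    rw [map_sub, nablaEnd_proj_tangent hcov hG, sub_zero]
  have hP (y z : TangentSpace 𝓘(ℝ, E) x) : B (z - F.proj g x z) y = F.proj g x (B z y) := by
    rw [map_sub, sub_apply, nablaEnd_proj_proj, sub_sub_cancel]
  have hw (w : TangentSpace 𝓘(ℝ, E) x) :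
      g.inner x (F.proj g x (B z y) + F.proj g x (B y z)) w = 0 := by
    -- Self-adjointness moves the arbitrary vector `w` out of `B`, so that the horizontal parts of
    -- `y` and `z` fill both slots.
    have h1 := key w y z
    rw [g.symm x (y - _), inner_nablaEnd_proj hcov, inner_nablaEnd_proj hcov, hP, hP, hBr, hBr] at h1
    rw [g.symm, map_add]
    exact h1
  by_contra hne
  exact (g.pos x _ fun h ↦ hne (eq_neg_iff_add_eq_zero.2 h)).ne' (hw _)

/-- Differentiate `PJ = JP` using `∇J = 0`. -/
theorem nablaEnd_proj_J (hK : IsKahler g J) (hcov : IsLeviCivita g cov)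
    (hC : F.HasComplexLeaves J) {x : M} (y v : TangentSpace 𝓘(ℝ, E) x) :
    nablaEnd cov (F.smoothEndo_proj g) x (J.toFun x y) v =
      J.toFun x (nablaEnd cov (F.smoothEndo_proj g) x y v) := by
  have hs := F.smoothEndo_proj g
  have hy := mdifferentiableAt_extend y
  have h1 := nablaEnd_apply cov hs (J.mdifferentiableAt hy) v
  simp only [proj_J hK hC, FiberBundle.extend_apply_self] at h1
  rw [h1, hK.cov_J hcov hy, hK.cov_J hcov (hs.mdifferentiableAt hy), cov_endo cov hs hy,
    proj_J hK hC, ← map_sub, add_sub_cancel_right, FiberBundle.extend_apply_self]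

theorem kahlerSplitting (hK : IsKahler g J) (hR : F.IsRiemannian g) (hG : F.IsTotallyGeodesic g)
    (hC : F.HasComplexLeaves J) (hcov : IsLeviCivita g cov) (x : M) :
    KahlerSplitting (g.inner x) (F.proj g x) (J.toFun x)
      (nablaEnd cov (F.smoothEndo_proj g) x) where
  symm := g.symm x
  pos := g.pos x
  proj_proj := F.proj_proj g
  inner_proj := F.inner_proj_comm g
  proj_J := proj_J hK hC
  J_J := J.sq x
  inner_J := hK.1 x
  inner_B := inner_nablaEnd_proj hcov
  B_proj := nablaEnd_proj_proj
  B_proj_right := nablaEnd_proj_tangent hcov hG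
  proj_B_skew := proj_nablaEnd_skew hcov hR hG
  B_J := nablaEnd_proj_J hK hcov hC

end Foliation
end KahlerFoliations

/-! ### The deformed metric, complex structure and connections. -/

section LeafDeformation

/-- The transpose of a tensor of type `(1, 2)` at a point. -/
def tangentFlip {x : M}
    (B : TangentSpace 𝓘(ℝ, E) x →L[ℝ] TangentSpace 𝓘(ℝ, E) x →L[ℝ] TangentSpace 𝓘(ℝ, E) x) :
    TangentSpace 𝓘(ℝ, E) x →L[ℝ] TangentSpace 𝓘(ℝ, E) x →L[ℝ] TangentSpace 𝓘(ℝ, E) x :=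
  ContinuousLinearMap.flip (E := E) (F := E) (G := E) B

variable [FiniteDimensional ℝ E]

namespace Foliation

/-- The endomorphism field which is `1 + c` along the leaves and `1` on the normal distribution. -/
def leafScaling (F : Foliation E M) (g : Metric E M) (c : ℝ) (x : M) :
    TangentSpace 𝓘(ℝ, E) x →L[ℝ] TangentSpace 𝓘(ℝ, E) x :=
  ContinuousLinearMap.id ℝ _ + c • F.proj g x

theorem leafScaling_apply (F : Foliation E M) (g : Metric E M) (c : ℝ) {x : M}
    (v : TangentSpace 𝓘(ℝ, E) x) : F.leafScaling g c x v = v + c • F.proj g x v :=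
  rfl

theorem smoothEndo_leafScaling (F : Foliation E M) (g : Metric E M) (c : ℝ) :
    SmoothEndo (F.leafScaling g c) :=
  smoothEndo_id.add ((F.smoothEndo_proj g).const_smul c)

theorem cov_leafScaling (F : Foliation E M) (g : Metric E M) (c : ℝ) (cov : AffineConnection E M)
    {Y : ∀ x : M, TangentSpace 𝓘(ℝ, E) x} {x : M}
    (hY : MDifferentiableAt 𝓘(ℝ, E) 𝓘(ℝ, E).tangent (T% Y) x) (v : TangentSpace 𝓘(ℝ, E) x) :
    cov (fun y ↦ F.leafScaling g c y (Y y)) x v =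
      cov Y x v + c • (nablaEnd cov (F.smoothEndo_proj g) x (Y x) v + F.proj g x (cov Y x v)) := by
  have hPY := (F.smoothEndo_proj g).mdifferentiableAt hY
  rw [← cov_endo cov (F.smoothEndo_proj g) hY, ← cov_fun_smul hPY,
    ← cov_fun_add hY (mdifferentiableAt_fun_smul hPY c)]
  rfl

/-- The difference of the two sides is half the squared norm of `v - P v`. The bound gives both
positivity and boundedness of the unit balls of the halved metric. -/
theorem inner_leafScaling_self (F : Foliation E M) (g : Metric E M) {x : M}
    (v : TangentSpace 𝓘(ℝ, E) x) :
    (1 / 2) * g.inner x v v ≤ g.inner x (F.leafScaling g (-(1 / 2)) x v) v := by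
  have hnn (w : TangentSpace 𝓘(ℝ, E) x) : 0 ≤ g.inner x w w := by
    by_cases hw : w = 0
    · simp [hw]
    · exact (g.pos x w hw).le
  have h1 := hnn (v - F.proj g x v)
  have h2 := F.inner_proj_left g v v
  have h3 := F.inner_proj_comm g v v
  simp only [leafScaling_apply, map_add, map_sub, map_smul, sub_apply, add_apply, smul_apply,
    smul_eq_mul] at h1 ⊢
  linarith

/-- The metric `g` halved along the leaves. -/
def halvedMetric (F : Foliation E M) (g : Metric E M) : Metric E M where
  inner x := g.inner x ∘L F.leafScaling g (-(1 / 2)) x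
  symm x v w := by
    simp only [ContinuousLinearMap.comp_apply, leafScaling_apply, map_add, map_smul, add_apply,
      smul_apply]
    rw [F.inner_proj_comm, g.symm x v w, g.symm x v]
  pos x v hv := by
    have h1 := F.inner_leafScaling_self g v
    have h2 := g.pos x v hv
    rw [ContinuousLinearMap.comp_apply]
    linarith
  isVonNBounded x := by
    -- A vector of new squared norm below `1` has `g`-squared norm below `2`, so doubling the
    -- `g`-unit ball suffices.
    have h := (g.isVonNBounded x).image ((2 : ℝ) • ContinuousLinearMap.id ℝ (TangentSpace 𝓘(ℝ, E) x))
    refine h.subset fun v hv ↦ (mem_image _ _ _).2 ⟨(1 / 2 : ℝ) • v, ?_, by simp⟩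
    have h1 := F.inner_leafScaling_self g v
    simp only [mem_ofPred_eq, ContinuousLinearMap.comp_apply, map_smul, smul_apply,
      smul_eq_mul] at hv ⊢
    linarith
  contMDiff := (smoothForm_metric g).comp (F.smoothEndo_leafScaling g _)

theorem halvedMetric_apply (F : Foliation E M) (g : Metric E M) {x : M}
    (v w : TangentSpace 𝓘(ℝ, E) x) :
    (F.halvedMetric g).inner x v w = g.inner x v w - (1 / 2) * g.inner x (F.proj g x v) w := by
  change g.inner x (F.leafScaling g (-(1 / 2)) x v) w = _
  simp only [leafScaling_apply, map_add, map_smul, add_apply, smul_apply, smul_eq_mul]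
  ring

theorem isLeafHalving_halvedMetric (F : Foliation E M) (g : Metric E M) :
    F.IsLeafHalving g (F.halvedMetric g) where
  vertical x v hv w hw := by
    rw [halvedMetric_apply, F.proj_of_mem g hv]
    ring
  horizontal x v hv w hw := by
    rw [halvedMetric_apply, F.proj_of_mem_normal g hv]
    simp
  mixed x v hv w hw := by
    rw [halvedMetric_apply, F.proj_of_mem g hv, hw v hv]
    simp

variable {F : Foliation E M} {g : Metric E M} {J : AlmostComplex E M} {cov : AffineConnection E M}

/-- The almost complex structure `J` with its sign changed along the leaves. -/
def reversedJ (hK : IsKahler g J) (hC : F.HasComplexLeaves J) : AlmostComplex E M where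
  toFun x := J.toFun x ∘L F.leafScaling g (-2) x
  contMDiff := J.smoothEndo.comp (F.smoothEndo_leafScaling g _)
  sq x v := by
    simp only [ContinuousLinearMap.comp_apply, leafScaling_apply, map_add, map_smul,
      proj_J hK hC, F.proj_proj, J.sq]
    module

theorem reversedJ_apply (hK : IsKahler g J) (hC : F.HasComplexLeaves J) {x : M}
    (v : TangentSpace 𝓘(ℝ, E) x) :
    (reversedJ hK hC).toFun x v = J.toFun x v - (2 : ℝ) • J.toFun x (F.proj g x v) := by
  change J.toFun x (F.leafScaling g (-2) x v) = _
  rw [leafScaling_apply, map_add, map_smul]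
  module

theorem isLeafReversal_reversedJ (hK : IsKahler g J) (hC : F.HasComplexLeaves J) :
    F.IsLeafReversal g J (reversedJ hK hC) where
  vertical x v hv := by
    rw [reversedJ_apply, F.proj_of_mem g hv]
    module
  horizontal x v hv := by
    rw [reversedJ_apply, F.proj_of_mem_normal g hv]
    simp

theorem isAlmostHermitian_reversedJ (hK : IsKahler g J) (hC : F.HasComplexLeaves J) :
    IsAlmostHermitian (F.halvedMetric g) (reversedJ hK hC) := by
  intro x v w
  have h1 : F.proj g x ((reversedJ hK hC).toFun x v) = - J.toFun x (F.proj g x v) := by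
    rw [reversedJ_apply, map_sub, map_smul, proj_J hK hC, proj_J hK hC, F.proj_proj]
    module
  rw [halvedMetric_apply, h1, halvedMetric_apply, reversedJ_apply, reversedJ_apply]
  simp only [map_sub, map_smul, map_neg, sub_apply, smul_apply, neg_apply, smul_eq_mul]
  rw [hK.1, hK.1, hK.1, hK.1, ← F.inner_proj_comm, ← F.inner_proj_left]
  ring

variable (F g cov) in
/-- The Levi-Civita connection of the halved metric. -/
def halvedConnection : AffineConnection E M :=
  cov.addOneForm fun x ↦
    (-(1 / 2) : ℝ) • (nablaEnd cov (F.smoothEndo_proj g) x ∘L F.proj g x +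
      tangentFlip (nablaEnd cov (F.smoothEndo_proj g) x ∘L F.proj g x))

theorem halvedConnection_apply (Y : ∀ x : M, TangentSpace 𝓘(ℝ, E) x) (x : M)
    (v : TangentSpace 𝓘(ℝ, E) x) :
    F.halvedConnection g cov Y x v = cov Y x v +
      ((-(1 / 2) : ℝ) • (nablaEnd cov (F.smoothEndo_proj g) x ∘L F.proj g x +
        tangentFlip (nablaEnd cov (F.smoothEndo_proj g) x ∘L F.proj g x))) (Y x) v :=
  rfl

theorem correction_apply {x : M} (y v : TangentSpace 𝓘(ℝ, E) x) :
    ((-(1 / 2) : ℝ) • (nablaEnd cov (F.smoothEndo_proj g) x ∘L F.proj g x +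
        tangentFlip (nablaEnd cov (F.smoothEndo_proj g) x ∘L F.proj g x))) y v =
      (-(1 / 2) : ℝ) • (nablaEnd cov (F.smoothEndo_proj g) x (F.proj g x y) v +
        nablaEnd cov (F.smoothEndo_proj g) x (F.proj g x v) y) :=
  rfl

/-- The correction is symmetric, so torsion is unchanged. For the metric, `g(SY, Z)` with `S = 1 -
½P` is differentiated by `cov`, and `inner_correction` absorbs the derivative of `S`. -/
theorem isLeviCivita_halvedConnection (hK : IsKahler g J) (hR : F.IsRiemannian g)
    (hG : F.IsTotallyGeodesic g) (hC : F.HasComplexLeaves J) (hcov : IsLeviCivita g cov) :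
    IsLeviCivita (F.halvedMetric g) (F.halvedConnection g cov) where
  torsion_free X Y x hX hY := by
    rw [← hcov.torsion_free X Y x hX hY, halvedConnection_apply, halvedConnection_apply,
      correction_apply, correction_apply]
    module
  metric Y Z x hY hZ v := by
    have h1 := (kahlerSplitting hK hR hG hC hcov x).inner_correction correction_apply (Y x) (Z x) v
    have h2 := hcov.metric _ Z x ((F.smoothEndo_leafScaling g (-(1 / 2))).mdifferentiableAt hY) hZ v
    rw [cov_leafScaling F g _ cov hY] at h2
    refine h2.trans ?_
    rw [halvedMetric_apply, halvedMetric_apply, halvedConnection_apply, halvedConnection_apply]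
    simp only [leafScaling_apply, map_add, map_smul, add_apply, smul_apply, smul_eq_mul] at h1 ⊢
    linarith

/-- As `∇J = 0`, the original connection differentiates only the factor `1 - 2P` of `J(1 - 2P)`; the
correction of the connection supplies the other terms. -/
theorem nablaJ_halvedConnection (hK : IsKahler g J) (hR : F.IsRiemannian g)
    (hG : F.IsTotallyGeodesic g) (hC : F.HasComplexLeaves J) (hcov : IsLeviCivita g cov) {x : M}
    (y v : TangentSpace 𝓘(ℝ, E) x) :
    nablaJ (F.halvedConnection g cov) (reversedJ hK hC) x y v =
      J.toFun x (-(2 : ℝ) • nablaEnd cov (F.smoothEndo_proj g) x y v +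
        nablaEnd cov (F.smoothEndo_proj g) x (F.proj g x y) v +
        nablaEnd cov (F.smoothEndo_proj g) x (F.proj g x v) y) := by
  have hy := mdifferentiableAt_extend y
  have h1 := nablaJ_apply (F.halvedConnection g cov) (reversedJ hK hC) hy v
  have h2 := hK.cov_J hcov ((F.smoothEndo_leafScaling g (-2)).mdifferentiableAt hy) v
  rw [cov_leafScaling F g _ cov hy] at h2
  rw [← (kahlerSplitting hK hR hG hC hcov x).nabla_reversal correction_apply]
  rw [halvedConnection_apply, halvedConnection_apply] at h1
  simp only [FiberBundle.extend_apply_self] at h1 h2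
  rw [h1, reversedJ_apply, reversedJ_apply]
  erw [h2]
  simp only [map_add, map_smul]
  module

theorem isNearlyKahler_halvedMetric (hK : IsKahler g J) (hR : F.IsRiemannian g)
    (hG : F.IsTotallyGeodesic g) (hC : F.HasComplexLeaves J) :
    IsNearlyKahler (F.halvedMetric g) (reversedJ hK hC) := by
  obtain ⟨cov, hcov, -⟩ := id hG
  refine ⟨isAlmostHermitian_reversedJ hK hC, F.halvedConnection g cov,
    isLeviCivita_halvedConnection hK hR hG hC hcov, fun x v ↦ ?_⟩
  rw [nablaJ_halvedConnection hK hR hG hC hcov]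
  exact (kahlerSplitting hK hR hG hC hcov x).nabla_reversal_self v

/-- The canonical Hermitian connection in terms of the original Levi-Civita connection. -/
theorem canonicalHermitian_eq (hK : IsKahler g J) (hR : F.IsRiemannian g)
    (hG : F.IsTotallyGeodesic g) (hC : F.HasComplexLeaves J) (hcov : IsLeviCivita g cov)
    {cov' : AffineConnection E M} (hcov' : IsLeviCivita (F.halvedMetric g) cov')
    {Y : ∀ x : M, TangentSpace 𝓘(ℝ, E) x} {x : M}
    (hY : MDifferentiableAt 𝓘(ℝ, E) 𝓘(ℝ, E).tangent (T% Y) x) (v : TangentSpace 𝓘(ℝ, E) x) :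
    canonicalHermitian cov' (reversedJ hK hC) Y x v =
      cov Y x v + (nablaEnd cov (F.smoothEndo_proj g) x (Y x) v -
        (2 : ℝ) • nablaEnd cov (F.smoothEndo_proj g) x (F.proj g x (Y x)) v) := by
  have hLC := isLeviCivita_halvedConnection hK hR hG hC hcov
  -- By uniqueness, `cov'` may be replaced by the explicit connection inside the tensor as well.
  have h1 (w : TangentSpace 𝓘(ℝ, E) x) : nablaJ cov' (reversedJ hK hC) x w v =
      nablaJ (F.halvedConnection g cov) (reversedJ hK hC) x w v := by
    have hw := mdifferentiableAt_extend w
    have e1 := nablaJ_apply cov' (reversedJ hK hC) hw v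
    have e2 := nablaJ_apply (F.halvedConnection g cov) (reversedJ hK hC) hw v
    rw [hcov'.unique hLC hw,
      hcov'.unique hLC ((reversedJ hK hC).mdifferentiableAt hw), ← e2] at e1
    simpa only [FiberBundle.extend_apply_self] using e1
  rw [canonicalHermitian_apply, h1, hcov'.unique hLC hY, halvedConnection_apply,
    nablaJ_halvedConnection hK hR hG hC hcov, reversedJ_apply, add_assoc,
    (kahlerSplitting hK hR hG hC hcov x).canonical_correction correction_apply]

end Foliation

end LeafDeformation

/-! ### Parallel symmetric forms and parallel transport. -/

section ParallelForms

/-- The form `Q` is parallel for the connection `cov`. -/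
def IsParallelForm (cov : AffineConnection E M)
    (Q : ∀ x : M, TangentSpace 𝓘(ℝ, E) x →L[ℝ] TangentSpace 𝓘(ℝ, E) x →L[ℝ] ℝ) : Prop :=
  ∀ (Y Z : ∀ x : M, TangentSpace 𝓘(ℝ, E) x) (x : M),
    MDifferentiableAt 𝓘(ℝ, E) 𝓘(ℝ, E).tangent (T% Y) x →
    MDifferentiableAt 𝓘(ℝ, E) 𝓘(ℝ, E).tangent (T% Z) x → ∀ v : TangentSpace 𝓘(ℝ, E) x,
    mvfderiv 𝓘(ℝ, E) (fun y ↦ Q y (Y y) (Z y)) x v = Q x (cov Y x v) (Z x) + Q x (Y x) (cov Z x v)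

variable {cov : AffineConnection E M}
  {Q : ∀ x : M, TangentSpace 𝓘(ℝ, E) x →L[ℝ] TangentSpace 𝓘(ℝ, E) x →L[ℝ] ℝ}
  {D : ∀ x : M, Submodule ℝ (TangentSpace 𝓘(ℝ, E) x)}

/-- The kernel of a parallel form is a parallel distribution. -/
theorem IsParallelForm.isParallel (hQ : IsParallelForm cov Q)
    (hD : ∀ x v, v ∈ D x ↔ ∀ w, Q x v w = 0) : IsParallel cov D := by
  intro U hU Y hY x hx v
  rw [hD]
  intro w
  have h1 := hQ Y (FiberBundle.extend E w) x
    ((hY.contMDiffOn.contMDiffAt (hU.mem_nhds hx)).mdifferentiableAt (by simp))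
    (mdifferentiableAt_extend w) v
  have h2 : (fun y ↦ Q y (Y y) (FiberBundle.extend E w y)) =ᶠ[𝓝 x] fun _ ↦ 0 := by
    filter_upwards [hU.mem_nhds hx] with y hy
    exact (hD y _).1 (hY.mem y hy) _
  have h3 : mvfderiv 𝓘(ℝ, E) (fun y ↦ Q y (Y y) (FiberBundle.extend E w y)) x v = 0 := by
    have h4 : HasMFDerivAt 𝓘(ℝ, E) 𝓘(ℝ, ℝ) (fun y ↦ Q y (Y y) (FiberBundle.extend E w y)) x
        (0 : TangentSpace 𝓘(ℝ, E) x →L[ℝ] ℝ) :=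
      (hasMFDerivAt_const (0 : ℝ) x).congr_of_eventuallyEq h2
    simp only [mvfderiv, h4.mfderiv]
    rfl
  rw [h3, (hD x _).1 (hY.mem x hx), add_zero, FiberBundle.extend_apply_self] at h1
  exact h1.symm

local notation "𝓣" => trivializationAt E (TangentSpace 𝓘(ℝ, E))

theorem mdifferentiableAt_symmL_const (x : M) (u : E) :
    MDifferentiableAt 𝓘(ℝ, E) 𝓘(ℝ, E).tangent
      (T% (fun y : M ↦ ((𝓣 x).symmL ℝ y u : TangentSpace 𝓘(ℝ, E) y))) x := by
  have hx : x ∈ (𝓣 x).baseSet := FiberBundle.mem_baseSet_trivializationAt' x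
  refine (mdifferentiableAt_extend ((𝓣 x).symmL ℝ x u)).congr_of_eventuallyEq ?_
  filter_upwards [eventually_mem_baseSet (E := E) x] with y hy
  rw [FiberBundle.extend, Trivialization.symmL_apply _ hy, Trivialization.symmL_apply _ hx,
    Trivialization.apply_mk_symm _ hx]

/-- Parallelism is tested on the local field with constant coordinate `u`, the one occurring in
`IsParallelAlong`. -/
theorem IsParallelForm.mvfderiv_formCoord (hQ : IsParallelForm cov Q) (hQs : SmoothForm Q)
    (hsymm : ∀ x v w, Q x v w = Q x w v) (x : M) (u : E) (v : TangentSpace 𝓘(ℝ, E) x) :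
    mvfderiv 𝓘(ℝ, E) (formCoord Q x) x v u u =
      2 * Q x (cov (fun y ↦ (𝓣 x).symmL ℝ y u) x v) ((𝓣 x).symmL ℝ x u) := by
  have hσ := mdifferentiableAt_symmL_const x u
  have hQx : MDifferentiableAt 𝓘(ℝ, E) 𝓘(ℝ, E →L[ℝ] E →L[ℝ] ℝ) (formCoord Q x) x :=
    (smoothForm_iff.1 hQs x).mdifferentiableAt (by simp)
  rw [← mvfderiv_clm_apply_const hQx,
    ← mvfderiv_clm_apply_const (mdifferentiableAt_clm_apply_const hQx u)]
  refine (hQ _ _ x hσ hσ v).trans ?_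
  rw [hsymm x ((𝓣 x).symmL ℝ x u)]
  ring

/-- In coordinates, the coefficients of `Q` contribute `2Q(∇_{γ'}σ, Y)`, with `σ` the
constant-coordinate field through `Y t`. The parallel transport equation makes each of the two
arguments contribute `-Q(∇_{γ'}σ, Y)`. -/
theorem IsParallelForm.hasDerivWithinAt (hQ : IsParallelForm cov Q) (hQs : SmoothForm Q)
    (hsymm : ∀ x v w, Q x v w = Q x w v) {γ : ℝ → M} {a b : ℝ}
    (hγ : ContMDiffOn 𝓘(ℝ, ℝ) 𝓘(ℝ, E) 1 γ (Icc a b))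
    {Y : ∀ t : ℝ, TangentSpace 𝓘(ℝ, E) (γ t)} (hY : IsParallelAlong cov γ a b Y) {t : ℝ}
    (ht : t ∈ Icc a b) :
    HasDerivWithinAt (fun s ↦ Q (γ s) (Y s) (Y s)) 0 (Icc a b) t := by
  have hy := hY t ht
  set y : ℝ → E := fun s ↦ (𝓣 (γ t)).continuousLinearMapAt ℝ (γ s) (Y s)
  set σ : ∀ x : M, TangentSpace 𝓘(ℝ, E) x := fun x ↦ (𝓣 (γ t)).symmL ℝ x (y t)
  set v : TangentSpace 𝓘(ℝ, E) (γ t) :=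
    mfderivWithin 𝓘(ℝ, ℝ) 𝓘(ℝ, E) γ (Icc a b) t (1 : ℝ)
  have hmem : γ t ∈ (𝓣 (γ t)).baseSet := FiberBundle.mem_baseSet_trivializationAt' _
  have hσt : (𝓣 (γ t)).symmL ℝ (γ t) (y t) = Y t :=
    Trivialization.symmL_continuousLinearMapAt _ hmem _
  have hγt := (hγ t ht).mdifferentiableWithinAt one_ne_zero
  have hQt : MDifferentiableAt 𝓘(ℝ, E) 𝓘(ℝ, E →L[ℝ] E →L[ℝ] ℝ) (formCoord Q (γ t)) (γ t) :=
    (smoothForm_iff.1 hQs (γ t)).mdifferentiableAt (by simp)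
  have hprod := ((hasDerivWithinAt_comp_curve hQt hγt).clm_apply hy).clm_apply hy
  have hcongr : (fun s ↦ Q (γ s) (Y s) (Y s)) =ᶠ[𝓝[Icc a b] t]
      fun s ↦ formCoord Q (γ t) (γ s) (y s) (y s) := by
    filter_upwards [hγt.continuousWithinAt (eventually_mem_baseSet (E := E) (γ t))] with s hs
    have h : (𝓣 (γ t)).symmL ℝ (γ s) (y s) = Y s :=
      Trivialization.symmL_continuousLinearMapAt _ hs _
    change _ = Q (γ s) ((𝓣 (γ t)).symmL ℝ (γ s) (y s)) ((𝓣 (γ t)).symmL ℝ (γ s) (y s))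
    rw [h]
  refine (hprod.congr_of_eventuallyEq hcongr (hcongr.self_of_nhdsWithin ht)).congr_deriv ?_
  have h1 (w z : E) : formCoord Q (γ t) (γ t) w z =
    Q (γ t) ((𝓣 (γ t)).symmL ℝ (γ t) w) ((𝓣 (γ t)).symmL ℝ (γ t) z) := rfl
  have h2 : (𝓣 (γ t)).symmL ℝ (γ t) (-(𝓣 (γ t)).continuousLinearMapAt ℝ (γ t) (cov σ (γ t) v)) =
      -cov σ (γ t) v := by
    rw [map_neg, Trivialization.symmL_continuousLinearMapAt _ hmem]
  rw [add_apply, hQ.mvfderiv_formCoord hQs hsymm, h1, h1, h2, hσt, map_neg, map_neg, neg_apply,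
    hsymm _ (Y t)]
  ring

theorem IsParallelForm.apply_eq_of_isParallelAlong (hQ : IsParallelForm cov Q)
    (hQs : SmoothForm Q) (hsymm : ∀ x v w, Q x v w = Q x w v) {γ : ℝ → M} {a b : ℝ} (hab : a ≤ b)
    (hγ : ContMDiffOn 𝓘(ℝ, ℝ) 𝓘(ℝ, E) 1 γ (Icc a b))
    {Y : ∀ t : ℝ, TangentSpace 𝓘(ℝ, E) (γ t)} (hY : IsParallelAlong cov γ a b Y) :
    Q (γ b) (Y b) (Y b) = Q (γ a) (Y a) (Y a) := by
  have h (t : ℝ) (ht : t ∈ Icc a b) := hQ.hasDerivWithinAt hQs hsymm hγ hY ht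
  refine constant_of_derivWithin_zero (f := fun s ↦ Q (γ s) (Y s) (Y s))
    (fun t ht ↦ (h t ht).differentiableWithinAt) (fun t ht ↦ ?_) b (right_mem_Icc.2 hab)
  exact (h t (Ico_subset_Icc_self ht)).derivWithin
    (uniqueDiffOn_Icc (ht.1.trans_lt ht.2) t (Ico_subset_Icc_self ht))

/-- Parallel transport preserves parallel forms. -/
theorem IsParallelForm.apply_eq_of_isParallelTransport (hQ : IsParallelForm cov Q)
    (hQs : SmoothForm Q) (hsymm : ∀ x v w, Q x v w = Q x w v) {p q : M}
    {τ : TangentSpace 𝓘(ℝ, E) p →L[ℝ] TangentSpace 𝓘(ℝ, E) q}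
    (hτ : IsParallelTransport cov p q τ) (v : TangentSpace 𝓘(ℝ, E) p) :
    Q q (τ v) (τ v) = Q p v v := by
  induction hτ with
  | refl => rfl
  | segment γ a b hab hγ τ σ _ hσ ih =>
    obtain ⟨Y, hY, hYa, hYb⟩ := hσ (τ v)
    rw [ContinuousLinearMap.comp_apply, ← ih, ← hYb, ← hYa]
    exact hQ.apply_eq_of_isParallelAlong hQs hsymm hab hγ hY

end ParallelForms

/-! ### The two parallel forms of the canonical connection. -/

theorem inner_self_eq_zero_iff {g : Metric E M} {x : M} {v : TangentSpace 𝓘(ℝ, E) x} :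
    g.inner x v v = 0 ↔ v = 0 := by
  refine ⟨fun h ↦ ?_, fun h ↦ by simp [h]⟩
  by_contra hne
  exact (g.pos x v hne).ne' h

namespace Foliation

variable [FiniteDimensional ℝ E] {F : Foliation E M} {g : Metric E M} {J : AlmostComplex E M}
  {cov : AffineConnection E M}

/-- Scaling with `-1` is the projection `1 - P`. The form is `g` minus the vertical form, so
`inner_parallel` and `inner_proj_parallel` combine. -/
theorem isParallelForm_normal (hK : IsKahler g J) (hR : F.IsRiemannian g)
    (hG : F.IsTotallyGeodesic g) (hC : F.HasComplexLeaves J)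
    (hcov : IsLeviCivita (F.halvedMetric g) cov) :
    IsParallelForm (canonicalHermitian cov (reversedJ hK hC))
      fun x ↦ g.inner x ∘L F.leafScaling g (-1) x := by
  intro Y Z x hY hZ v
  obtain ⟨cov₀, hcov₀, -⟩ := id hG
  have hS := kahlerSplitting hK hR hG hC hcov₀ x
  have h1 := hcov₀.metric _ Z x ((F.smoothEndo_leafScaling g (-1)).mdifferentiableAt hY) hZ v
  rw [cov_leafScaling F g _ cov₀ hY] at h1
  refine h1.trans ?_
  have h2 := hS.inner_parallel (Y x) (Z x) v
  have h3 := hS.inner_proj_parallel (Y x) (Z x) v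
  rw [canonicalHermitian_eq hK hR hG hC hcov₀ hcov hY,
    canonicalHermitian_eq hK hR hG hC hcov₀ hcov hZ]
  simp only [ContinuousLinearMap.comp_apply, leafScaling_apply, map_add, map_sub, map_smul,
    add_apply, sub_apply, smul_apply, smul_eq_mul] at h2 h3 ⊢
  linarith

theorem isParallelForm_tangent (hK : IsKahler g J) (hR : F.IsRiemannian g)
    (hG : F.IsTotallyGeodesic g) (hC : F.HasComplexLeaves J)
    (hcov : IsLeviCivita (F.halvedMetric g) cov) :
    IsParallelForm (canonicalHermitian cov (reversedJ hK hC)) fun x ↦ g.inner x ∘L F.proj g x := by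
  intro Y Z x hY hZ v
  obtain ⟨cov₀, hcov₀, -⟩ := id hG
  have hS := kahlerSplitting hK hR hG hC hcov₀ x
  have h1 := hcov₀.metric _ Z x ((F.smoothEndo_proj g).mdifferentiableAt hY) hZ v
  rw [cov_endo cov₀ (F.smoothEndo_proj g) hY] at h1
  refine h1.trans ?_
  have h3 := hS.inner_proj_parallel (Y x) (Z x) v
  rw [canonicalHermitian_eq hK hR hG hC hcov₀ hcov hY,
    canonicalHermitian_eq hK hR hG hC hcov₀ hcov hZ]
  simp only [ContinuousLinearMap.comp_apply, map_add, map_sub, map_smul,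
    add_apply, sub_apply, smul_apply, smul_eq_mul] at h3 ⊢
  linarith

/-- The quadratic form is the squared norm of the horizontal part; its null vectors form a linear
space, so membership can be tested on the diagonal. -/
theorem inner_leafScaling_eq_zero_iff {x : M} {v : TangentSpace 𝓘(ℝ, E) x} :
    g.inner x (F.leafScaling g (-1) x v) v = 0 ↔ v ∈ F.tangent x := by
  have h1 : g.inner x (F.leafScaling g (-1) x v) v =
      g.inner x (v - F.proj g x v) (v - F.proj g x v) := by
    have h2 := F.inner_proj_left g v v
    have h3 := F.inner_proj_comm g v v
    simp only [leafScaling_apply, map_add, map_sub, map_smul, sub_apply, add_apply, smul_apply,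
      smul_eq_mul]
    linarith
  rw [h1, inner_self_eq_zero_iff, sub_eq_zero, F.mem_tangent_iff g, eq_comm]

theorem inner_proj_eq_zero_iff {x : M} {v : TangentSpace 𝓘(ℝ, E) x} :
    g.inner x (F.proj g x v) v = 0 ↔ v ∈ F.normal g x := by
  rw [F.inner_proj_left, inner_self_eq_zero_iff, F.mem_normal_iff]

end Foliation


end KahlerFoliation

end

open KahlerFoliation in
theorem proposition7p1
    {E : Type*} [NormedAddCommGroup E] [NormedSpace ℝ E] [FiniteDimensional ℝ E]
    {M : Type*} [TopologicalSpace M] [T2Space M] [SecondCountableTopology M]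
    [ChartedSpace E M] [IsManifold 𝓘(ℝ, E) ∞ M]
    (g : KahlerFoliation.Metric E M) (J : AlmostComplex E M) (F : Foliation E M)
    (hK : IsKahler g J) (hR : F.IsRiemannian g) (hG : F.IsTotallyGeodesic g)
    (hC : F.HasComplexLeaves J) :
    ∃ (g' : KahlerFoliation.Metric E M) (J' : AlmostComplex E M),
      F.IsLeafHalving g g' ∧ F.IsLeafReversal g J J' ∧ IsNearlyKahler g' J' ∧
      ∀ cov : AffineConnection E M, IsLeviCivita g' cov →
        IsParallel (canonicalHermitian cov J') F.tangent ∧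
        IsParallel (canonicalHermitian cov J') (F.normal g) ∧
        ∀ (p : M), ∀ h ∈ holonomy (canonicalHermitian cov J') p,
          (∀ v ∈ F.tangent p, h v ∈ F.tangent p) ∧ (∀ v ∈ F.normal g p, h v ∈ F.normal g p) := by
  refine ⟨F.halvedMetric g, Foliation.reversedJ hK hC, F.isLeafHalving_halvedMetric g,
    Foliation.isLeafReversal_reversedJ hK hC, Foliation.isNearlyKahler_halvedMetric hK hR hG hC,
    fun cov hcov ↦ ?_⟩
  have hT := Foliation.isParallelForm_tangent hK hR hG hC hcov
  have hN := Foliation.isParallelForm_normal hK hR hG hC hcov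
  have hTs : SmoothForm fun x ↦ g.inner x ∘L F.proj g x :=
    (smoothForm_metric g).comp (F.smoothEndo_proj g)
  have hNs : SmoothForm fun x ↦ g.inner x ∘L F.leafScaling g (-1) x :=
    (smoothForm_metric g).comp (F.smoothEndo_leafScaling g (-1))
  have hTsymm (x : M) (v w : TangentSpace 𝓘(ℝ, E) x) :
      (g.inner x ∘L F.proj g x) v w = (g.inner x ∘L F.proj g x) w v := by
    rw [ContinuousLinearMap.comp_apply, ContinuousLinearMap.comp_apply, F.inner_proj_comm, g.symm]
  have hNsymm (x : M) (v w : TangentSpace 𝓘(ℝ, E) x) :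
      (g.inner x ∘L F.leafScaling g (-1) x) v w = (g.inner x ∘L F.leafScaling g (-1) x) w v := by
    simp only [ContinuousLinearMap.comp_apply, Foliation.leafScaling_apply, map_add, map_smul,
      add_apply, smul_apply]
    rw [F.inner_proj_comm, g.symm x v w, g.symm x v]
  refine ⟨hN.isParallel fun x v ↦ ⟨fun hv w ↦ ?_, fun h ↦ ?_⟩,
    hT.isParallel fun x v ↦ ⟨fun hv w ↦ ?_, fun h ↦ ?_⟩, fun p h hh ↦ ⟨fun v hv ↦ ?_, fun v hv ↦ ?_⟩⟩
  · rw [ContinuousLinearMap.comp_apply, Foliation.leafScaling_apply, F.proj_of_mem g hv]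
    simp
  · exact Foliation.inner_leafScaling_eq_zero_iff.1 (h v)
  · rw [ContinuousLinearMap.comp_apply, F.proj_of_mem_normal g hv]
    simp
  · exact Foliation.inner_proj_eq_zero_iff.1 (h v)
  -- Being vertical means that the horizontal quadratic form vanishes, a condition preserved by
  -- parallel transport; the horizontal case is dual.
  · rw [← Foliation.inner_leafScaling_eq_zero_iff (g := g)] at hv ⊢
    exact (hN.apply_eq_of_isParallelTransport hNs hNsymm hh v).trans hv
  · rw [← Foliation.inner_proj_eq_zero_iff] at hv ⊢
    exact (hT.apply_eq_of_isParallelTransport hTs hTsymm hh v).trans hv
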